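/- Let $N>1$ be an integer and let $\mathcal V=\{1,\dots,N\}$ be a set of players. Player $i$ has a scalar state $x_{i1}(t)\in\mathbb R$ with $\dot x_{i1}=u_i$ and action $y_i=x_{i1}$; write $\mathbf y=(y_1,\dots,y_N)^T$. Player $i$ has an objective function $f_i:\mathbb R^N\to\mathbb R$, and $\nabla_i f_i=\partial f_i/\partial y_i$. Assume: 1. every $f_i$ is continuously differentiable, and there are constants $l_i>0$ with $|\nabla_i f_i(\mathbf y)-\nabla_i f_i(\mathbf z)|\le l_i\|\mathbf y-\mathbf z\|$ for all $\mathbf y,\mathbf z\in\mathbb R^N$; 2. there is $\omega>0$ such that $\sum_{i=1}^N (y_i-z_i)\bigl(\nabla_i f_i(\mathbf y)-\nabla_i f_i(\mathbf z)\bigr)\ge\omega\|\mathbf y-\mathbf z\|^2$ for all $\mathbf y,\mathbf z\in\mathbb R^N$; 3. the players communicate over a strongly connected directed graph on $\mathcal V$ with weights $a_{ij}$, where $a_{ji}>0$ if $(i,j)$ is an edge (from $i$ to $j$), $a_{ji}=0$ otherwise, and $a_{ii}=0$. Let $\Delta_i>0$ and $\phi_i(s)=\operatorname{sign}(s)\min\{|s|,\Delta_i\}$.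 For $t\ge 0$ consider the closed-loop system, with $\mathbf z_i=(z_{i1},\dots,z_{iN})^T$ and $i,j\in\mathcal V$, $$\dot x_{i1}=u_i=-\phi_i\Bigl(x_{i1}+\int_0^t\nabla_i f_i(\mathbf z_i(\tau))\,d\tau\Bigr),\qquad \dot z_{ij}=-(c_{ij}+\rho_{ij})\,\xi_{ij},\qquad \dot c_{ij}=\rho_{ij},$$ $$\xi_{ij}=\sum_{k=1}^N a_{ik}(z_{ij}-z_{kj})+a_{ij}\Bigl(z_{ij}+\int_0^t\nabla_j f_j(\mathbf z_j(\tau))\,d\tau\Bigr),\qquad \rho_{ij}=\xi_{ij}^2,$$ with arbitrary initial values $x_{i1}(0)$, $z_{ij}(0)\in\mathbb R$ and $c_{ij}(0)>0$. Then the game has a unique Nash equilibrium $\mathbf y^*$, that is, a unique point with $f_i(y_i^*,\mathbf y_{-i}^*)\le f_i(y_i,\mathbf y_{-i}^*)$ for all $y_i\in\mathbb R$ and $i\in\mathcal V$. For all such initial values the closed-loop system has a solution on $[0,\infty)$, and every such solution satisfies $$\lim_{t\to\infty}\|\mathbf y(t)-\mathbf y^*\|=0.$$ Moreover, all the other variables,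 namely $x_{i1}$, $z_{ij}$, $c_{ij}$, $\rho_{ij}$, $\int_0^t\nabla_i f_i(\mathbf z_i(\tau))\,d\tau$ and $u_i$ for all $i,j\in\mathcal V$, are bounded on $[0,\infty)$ and converge to finite values as $t\to\infty$. -/

import Mathlib

open Filter Topology

noncomputable section

namespace NashSeeking

/-- Partial derivative `∂ f_i / ∂ y_i` of the `i`-th objective with respect to the action of
player `i`, evaluated at `y`. -/
def partialGrad {N : ℕ} (f : Fin N → EuclideanSpace ℝ (Fin N) → ℝ) (i : Fin N)
    (y : EuclideanSpace ℝ (Fin N)) : ℝ :=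
  lineDeriv ℝ (f i) y (EuclideanSpace.single i (1 : ℝ))

/-- The action profile in which player `i` plays `s` and all others play as in `y`. -/
def deviate {N : ℕ} (y : EuclideanSpace ℝ (Fin N)) (i : Fin N) (s : ℝ) :
    EuclideanSpace ℝ (Fin N) :=
  WithLp.toLp 2 (Function.update y.ofLp i s)

/-- Nash equilibrium: no player can lower its objective by a unilateral deviation. -/
def IsNashEquilibrium {N : ℕ} (f : Fin N → EuclideanSpace ℝ (Fin N) → ℝ)
    (yStar : EuclideanSpace ℝ (Fin N)) : Prop :=
  ∀ (i : Fin N) (s : ℝ), f i yStar ≤ f i (deviate yStar i s)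

/-- The objectives are continuously differentiable and each `∂ f_i / ∂ y_i` is globally
Lipschitz. -/
def SmoothLipschitz {N : ℕ} (f : Fin N → EuclideanSpace ℝ (Fin N) → ℝ) : Prop :=
  (∀ i, ContDiff ℝ 1 (f i)) ∧
  ∃ l : Fin N → ℝ, (∀ i, 0 < l i) ∧
    ∀ (i : Fin N) (y z : EuclideanSpace ℝ (Fin N)),
      |partialGrad f i y - partialGrad f i z| ≤ l i * ‖y - z‖

/-- Strong monotonicity of the pseudo-gradient. -/
def StronglyMonotone {N : ℕ} (f : Fin N → EuclideanSpace ℝ (Fin N) → ℝ) : Prop :=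
  ∃ ω : ℝ, 0 < ω ∧ ∀ y z : EuclideanSpace ℝ (Fin N),
    ω * ‖y - z‖ ^ 2 ≤ ∑ i, (y i - z i) * (partialGrad f i y - partialGrad f i z)

/-- A weighted directed graph on the players, without self-loops. `Adj i j` says that `(i, j)` is
an edge (from `i` to `j`), and its weight is `weight j i`, written `a_{ji}`. -/
structure CommGraph (N : ℕ) extends Digraph (Fin N) where
  weight : Fin N → Fin N → ℝ
  weight_pos : ∀ i j, Adj i j → 0 < weight j i
  weight_eq_zero : ∀ i j, ¬ Adj i j → weight j i = 0
  weight_self : ∀ i, weight i i = 0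

/-- Every node can be reached from every other one along a directed path. -/
def CommGraph.StronglyConnected {N : ℕ} (G : CommGraph N) : Prop :=
  ∀ i j : Fin N, i ≠ j → Relation.TransGen G.Adj i j

/-- The saturation function `φ(s) = sign(s) min{|s|, D}`. -/
def sat (D s : ℝ) : ℝ := Real.sign s * min |s| D

/-- `∫₀ᵗ ∂ f_j / ∂ y_j (z_j(τ)) dτ`, where `z τ j` is the estimate vector of player `j`. -/
def gradIntegral {N : ℕ} (f : Fin N → EuclideanSpace ℝ (Fin N) → ℝ)
    (z : ℝ → Fin N → EuclideanSpace ℝ (Fin N)) (j : Fin N) (t : ℝ) : ℝ :=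
  ∫ τ in (0 : ℝ)..t, partialGrad f j (z τ j)

/-- The single-saturation control input of player `i`. -/
def controlInput {N : ℕ} (f : Fin N → EuclideanSpace ℝ (Fin N) → ℝ) (Δ : Fin N → ℝ)
    (x : ℝ → Fin N → ℝ) (z : ℝ → Fin N → EuclideanSpace ℝ (Fin N)) (i : Fin N) (t : ℝ) : ℝ :=
  - sat (Δ i) (x t i + gradIntegral f z i t)

/-- The local disagreement driving the estimate `z_{ij}`. -/
def disagreement {N : ℕ} (f : Fin N → EuclideanSpace ℝ (Fin N) → ℝ) (G : CommGraph N)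
    (z : ℝ → Fin N → EuclideanSpace ℝ (Fin N)) (i j : Fin N) (t : ℝ) : ℝ :=
  (∑ k, G.weight i k * (z t i j - z t k j)) + G.weight i j * (z t i j + gradIntegral f z j t)

/-- The time-varying gain `ρ_{ij}`. -/
def rho {N : ℕ} (f : Fin N → EuclideanSpace ℝ (Fin N) → ℝ) (G : CommGraph N)
    (z : ℝ → Fin N → EuclideanSpace ℝ (Fin N)) (i j : Fin N) (t : ℝ) : ℝ :=
  disagreement f G z i j t ^ 2

/-- `(x, z, c)` is a solution on `[0, ∞)` of the closed-loop system. -/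
structure IsTrajectory {N : ℕ} (f : Fin N → EuclideanSpace ℝ (Fin N) → ℝ) (G : CommGraph N)
    (Δ : Fin N → ℝ) (x : ℝ → Fin N → ℝ) (z : ℝ → Fin N → EuclideanSpace ℝ (Fin N))
    (c : ℝ → Fin N → Fin N → ℝ) : Prop where
  state_eq : ∀ (i : Fin N) (t : ℝ), 0 ≤ t →
    HasDerivWithinAt (fun s => x s i) (controlInput f Δ x z i t) (Set.Ici 0) t
  estimate_eq : ∀ (i j : Fin N) (t : ℝ), 0 ≤ t →
    HasDerivWithinAt (fun s => z s i j)
      (-(c t i j + rho f G z i j t) * disagreement f G z i j t) (Set.Ici 0) t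
  gain_eq : ∀ (i j : Fin N) (t : ℝ), 0 ≤ t →
    HasDerivWithinAt (fun s => c s i j) (rho f G z i j t) (Set.Ici 0) t

/-- The action profile `y(t)`, with `y_i = x_{i1}`. -/
def output {N : ℕ} (x : ℝ → Fin N → ℝ) (t : ℝ) : EuclideanSpace ℝ (Fin N) :=
  WithLp.toLp 2 (x t)

/-- The signal is bounded on `[0, ∞)` and has a finite limit as `t → ∞`. -/
def BoundedConvergent (g : ℝ → ℝ) : Prop :=
  (∃ M : ℝ, ∀ t : ℝ, 0 ≤ t → |g t| ≤ M) ∧ ∃ L : ℝ, Tendsto g atTop (𝓝 L)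

end NashSeeking

end

open Filter Topology NashSeeking

/-!
# Convergence of a saturated Nash seeking law with fully distributed adaptive consensus

By strong monotonicity, a Nash equilibrium is the same as a zero of the pseudo-gradient
(`isNashEquilibrium_iff`), and a relaxation of the pseudo-gradient is a contraction, which gives
existence and uniqueness.

Put `η_j = -∫₀ᵗ ∂_j f_j(z_j)`. Then `z_{ij}` is node `i`'s estimate of the reference `η_j`, and the
disagreement `ξ_{ij}` is the Laplacian of the graph, pinned to `η_j` at the out-neighbours of `j`,
applied to the tracking error. The subsystem `(η, z, c)` does not involve the states `x`, and has
the Lyapunov function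
`V = κ/2 ∑_j (η_j - y*_j)² + ∑_{ij} w_i (c_{ij} + ξ_{ij}²/2) ξ_{ij}² + 1/2 ∑_{ij} w_i (c_{ij} - α)²`,
in which `w` is a positive left null vector of the Laplacian
(`CommGraph.StronglyConnected.exists_pos_left_null`). In the metric `diag w` all the pinned
Laplacians are positive definite (`CommGraph.StronglyConnected.exists_pinned_form_lower_bound`), and
for `κ` and then `α` large this gives `V' ≤ -(∑ (η_j - y*_j)² + ∑ ξ_{ij}²)`
(`exists_lyapunovRate_le`).

Hence everything in the subsystem is bounded. The gains are monotone, so they converge; then `V`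
without its gain part converges too, and its limit is `0`, since a positive limit would keep `V'`
away from `0` (`tendsto_of_closedLoop`). So `η → y*` and `z_{ij} → y*_j`. Finally, each state `x_i`
tracks the convergent reference `η_i` with a saturated velocity (`tendsto_of_saturated_tracking`).

For existence, the vector field is cut off outside a cube. The cut-off field is bounded and globally
Lipschitz, so it has global solutions (`IsBoundedLipschitz.exists_solution`), and the bound on `V`
shows that the cutoff is never active if the cube is large (`exists_closedLoop_solution`).
-/



namespace NashSeeking

/-! ### Nash equilibria and the pseudo-gradient -/

section Nash

variable {N : ℕ} {f : Fin N → EuclideanSpace ℝ (Fin N) → ℝ}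

theorem deviate_eq_add (y : EuclideanSpace ℝ (Fin N)) (i : Fin N) (s : ℝ) :
    deviate y i s = y + (s - y i) • EuclideanSpace.single i (1 : ℝ) := by
  ext k
  by_cases h : k = i
  · subst h; simp [deviate]
  · simp [deviate, h]

theorem deviate_self (y : EuclideanSpace ℝ (Fin N)) (i : Fin N) : deviate y i (y i) = y := by
  simp [deviate_eq_add]

theorem hasDerivAt_deviate (hf : SmoothLipschitz f) (i : Fin N)
    (y : EuclideanSpace ℝ (Fin N)) (s : ℝ) :
    HasDerivAt (fun s => f i (deviate y i s)) (partialGrad f i (deviate y i s)) s := by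
  have hd : DifferentiableAt ℝ (f i) (deviate y i s) :=
    ((hf.1 i).differentiable (by norm_num)).differentiableAt
  have h1 : HasDerivAt (fun s : ℝ => deviate y i s) (EuclideanSpace.single i (1 : ℝ)) s := by
    have : HasDerivAt (fun s : ℝ => y + (s - y i) • EuclideanSpace.single i (1 : ℝ))
        ((1 : ℝ) • EuclideanSpace.single i (1 : ℝ)) s :=
      (((hasDerivAt_id s).sub_const (y i)).smul_const _).const_add y
    rw [one_smul] at this
    exact this.congr_of_eventuallyEq (Eventually.of_forall fun s => deviate_eq_add y i s)
  have := hd.hasFDerivAt.comp_hasDerivAt s h1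
  rw [partialGrad, hd.lineDeriv_eq_fderiv]
  exact this

/-- Strong monotonicity makes `s ↦ f_i(s, y_{-i})` increase away from a zero of its derivative, so
the stationarity of every player is sufficient for a Nash equilibrium as well as necessary. -/
theorem isNashEquilibrium_iff (hf : SmoothLipschitz f) (hmono : StronglyMonotone f)
    (y : EuclideanSpace ℝ (Fin N)) :
    IsNashEquilibrium f y ↔ ∀ i, partialGrad f i y = 0 := by
  constructor
  · intro h i
    have hmin : IsLocalMin (fun s => f i (deviate y i s)) (y i) :=
      Eventually.of_forall fun s => by
        simpa only [deviate_self] using h i s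
    have := hmin.hasDerivAt_eq_zero (hasDerivAt_deviate hf i y (y i))
    rwa [deviate_self] at this
  · intro h i s
    obtain ⟨ω, hω, hm⟩ := hmono
    have key : ∀ r : ℝ, 0 ≤ (r - y i) * partialGrad f i (deviate y i r) := by
      intro r
      have h1 := hm (deviate y i r) y
      rw [Finset.sum_eq_single i] at h1
      · rw [h i, sub_zero] at h1
        have h2 : deviate y i r i = r := by simp [deviate]
        rw [h2] at h1
        exact le_trans (by positivity) h1
      · intro k _ hk
        simp [deviate, hk]
      · simp
    have hd := hasDerivAt_deviate hf i y
    have hc : Continuous fun s => f i (deviate y i s) :=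
      continuous_iff_continuousAt.2 fun s => (hd s).continuousAt
    have h0 : f i y = f i (deviate y i (y i)) := by rw [deviate_self]
    rw [h0]
    rcases lt_trichotomy (y i) s with hs | hs | hs
    · obtain ⟨r, hr, he⟩ := exists_hasDerivAt_eq_slope _ _ hs hc.continuousOn (fun r _ => hd r)
      have h3 : 0 ≤ partialGrad f i (deviate y i r) :=
        nonneg_of_mul_nonneg_right (key r) (sub_pos.2 hr.1)
      rw [he] at h3
      rw [le_div_iff₀ (sub_pos.2 hs)] at h3
      linarith
    · rw [hs]
    · obtain ⟨r, hr, he⟩ := exists_hasDerivAt_eq_slope _ _ hs hc.continuousOn (fun r _ => hd r)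
      have h3 : partialGrad f i (deviate y i r) ≤ 0 := by
        by_contra hcon
        push Not at hcon
        have := key r
        nlinarith [hr.2]
      rw [he, div_le_iff₀ (sub_pos.2 hs)] at h3
      linarith

theorem exists_stationary (hf : SmoothLipschitz f) (hmono : StronglyMonotone f) :
    ∃ y, ∀ i, partialGrad f i y = 0 := by
  obtain ⟨-, l, hl, hlip⟩ := hf
  obtain ⟨ω, hω, hm⟩ := hmono
  set F : EuclideanSpace ℝ (Fin N) → EuclideanSpace ℝ (Fin N) :=
    fun y => WithLp.toLp 2 fun i => partialGrad f i y with hF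
  set S : ℝ := ∑ i, l i ^ 2 with hS
  have hS0 : 0 ≤ S := Finset.sum_nonneg fun i _ => sq_nonneg _
  have hFl : ∀ y z, ‖F y - F z‖ ^ 2 ≤ S * ‖y - z‖ ^ 2 := by
    intro y z
    rw [EuclideanSpace.real_norm_sq_eq, hS, Finset.sum_mul]
    refine Finset.sum_le_sum fun i _ => ?_
    have := hlip i y z
    rw [← mul_pow, ← sq_abs]
    exact pow_le_pow_left₀ (abs_nonneg _) (by simpa [hF] using this) 2
  -- the relaxation step minimizing, up to the `ω²` that keeps the denominator positive, the
  -- contraction factor `1 - 2τω + τ²S`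
  set τ : ℝ := ω / (S + ω ^ 2) with hτ
  have hD : 0 < S + ω ^ 2 := by positivity
  have hτ0 : 0 < τ := by positivity
  have hτS : τ * S ≤ ω := by
    rw [hτ, div_mul_eq_mul_div, div_le_iff₀ hD]
    nlinarith [pow_pos hω 3]
  have hq0 : 0 ≤ 1 - τ * ω := by
    rw [hτ, div_mul_eq_mul_div, sub_nonneg, div_le_one hD]
    nlinarith
  have hq1 : 1 - τ * ω < 1 := by nlinarith
  set T : EuclideanSpace ℝ (Fin N) → EuclideanSpace ℝ (Fin N) := fun y => y - τ • F y with hT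
  have hTl : ∀ y z, ‖T y - T z‖ ^ 2 ≤ (1 - τ * ω) * ‖y - z‖ ^ 2 := by
    intro y z
    have e1 : T y - T z = (y - z) - τ • (F y - F z) := by
      simp only [hT, smul_sub]; abel
    have e2 : inner ℝ (y - z) (F y - F z) =
        ∑ i, (y i - z i) * (partialGrad f i y - partialGrad f i z) := by
      simp [PiLp.inner_apply, hF, mul_comm]
    rw [e1, @norm_sub_sq ℝ, inner_smul_right, norm_smul, e2, mul_pow, Real.norm_eq_abs, sq_abs]
    have h1 := hm y z
    have h2 := hFl y z
    simp only [RCLike.re_to_real]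
    have h3 : τ ^ 2 * ‖F y - F z‖ ^ 2 ≤ τ ^ 2 * (S * ‖y - z‖ ^ 2) := by gcongr
    have h4 : τ * (ω * ‖y - z‖ ^ 2) ≤
        τ * ∑ i, (y i - z i) * (partialGrad f i y - partialGrad f i z) := by gcongr
    have h5 : τ * ‖y - z‖ ^ 2 * (τ * S) ≤ τ * ‖y - z‖ ^ 2 * ω := by gcongr
    nlinarith
  have hcon : ContractingWith (Real.toNNReal (Real.sqrt (1 - τ * ω))) T := by
    refine ⟨?_, LipschitzWith.of_dist_le_mul fun y z => ?_⟩
    · rw [← NNReal.coe_lt_coe, Real.coe_toNNReal _ (Real.sqrt_nonneg _), NNReal.coe_one,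
        Real.sqrt_lt' one_pos]
      simpa using hq1
    · rw [Real.coe_toNNReal _ (Real.sqrt_nonneg _), dist_eq_norm, dist_eq_norm]
      refine abs_le_of_sq_le_sq' ?_ (by positivity) |>.2
      rw [mul_pow, Real.sq_sqrt hq0]
      exact hTl y z
  refine ⟨hcon.fixedPoint T, fun i => ?_⟩
  have hfix : T (hcon.fixedPoint T) = hcon.fixedPoint T := hcon.fixedPoint_isFixedPt
  have h1 : τ • F (hcon.fixedPoint T) = 0 := by
    simpa [hT] using hfix
  have h2 := (smul_eq_zero.1 h1).resolve_left hτ0.ne'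
  have h3 := congrArg (fun v : EuclideanSpace ℝ (Fin N) => v i) h2
  simpa [hF] using h3

theorem existsUnique_isNashEquilibrium (hf : SmoothLipschitz f) (hmono : StronglyMonotone f) :
    ∃! y, IsNashEquilibrium f y := by
  obtain ⟨y, hy⟩ := exists_stationary hf hmono
  refine ⟨y, (isNashEquilibrium_iff hf hmono y).2 hy, fun z hz => ?_⟩
  replace hz := (isNashEquilibrium_iff hf hmono z).1 hz
  obtain ⟨ω, hω, hm⟩ := hmono
  have h := hm z y
  simp only [hy, hz, sub_self, mul_zero, Finset.sum_const_zero] at h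
  have h1 : ‖z - y‖ ^ 2 ≤ 0 := by
    by_contra hc
    push Not at hc
    nlinarith
  have h2 : ‖z - y‖ = 0 := by
    have := sq_nonneg ‖z - y‖
    exact pow_eq_zero_iff (two_ne_zero) |>.1 (le_antisymm h1 this)
  exact sub_eq_zero.1 (norm_eq_zero.1 h2)

end Nash

/-! ### The Laplacian of a strongly connected digraph -/

section Graph

variable {N : ℕ} {G : CommGraph N}

theorem CommGraph.weight_nonneg (G : CommGraph N) (i j : Fin N) : 0 ≤ G.weight i j := by
  by_cases h : G.Adj j i
  · exact (G.weight_pos j i h).le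
  · exact (G.weight_eq_zero j i h).ge

/-- In a strongly connected graph, a property that holds somewhere and passes along the edges holds
everywhere. -/
theorem CommGraph.StronglyConnected.forall_of_exists (hG : G.StronglyConnected) {p : Fin N → Prop}
    (hstep : ∀ i j, G.Adj i j → p i → p j) {i : Fin N} (hi : p i) (j : Fin N) : p j := by
  by_cases hij : i = j
  · exact hij ▸ hi
  · have h := hG i j hij
    induction h with
    | single h => exact hstep _ _ h hi
    | tail _ h ih =>
      rename_i b c _
      by_cases hb : i = b
      · exact hstep _ _ h (hb ▸ hi)
      · exact hstep _ _ h (ih hb)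

/-- The Laplacian of a strongly connected graph has a positive left null vector. For any left null
vector `v`, the triangle inequality and the equality of total in- and out-flow show that `|v|` is a
left null vector too, and its zero set is closed under passing along edges. -/
theorem CommGraph.StronglyConnected.exists_pos_left_null (hG : G.StronglyConnected) (hN : 0 < N) :
    ∃ w : Fin N → ℝ, (∀ i, 0 < w i) ∧
      ∀ k, ∑ i, w i * G.weight i k = w k * ∑ i, G.weight k i := by
  set L : Matrix (Fin N) (Fin N) ℝ :=
    Matrix.diagonal (fun i => ∑ k, G.weight i k) - Matrix.of G.weight with hL
  have hone : L.mulVec (fun _ => 1) = 0 := by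
    ext i
    rw [hL, Matrix.sub_mulVec, Pi.sub_apply, Matrix.mulVec_diagonal]
    simp [Matrix.mulVec, dotProduct]
  have hne : (fun _ => 1 : Fin N → ℝ) ≠ 0 := fun h => by
    simpa using congrFun h ⟨0, hN⟩
  have hdet : L.det = 0 := Matrix.exists_mulVec_eq_zero_iff.1 ⟨_, hne, hone⟩
  obtain ⟨v, hv, hvL⟩ := Matrix.exists_vecMul_eq_zero_iff.2 hdet
  have hv' : ∀ k, ∑ i, v i * G.weight i k = v k * ∑ i, G.weight k i := by
    intro k
    have := congrFun hvL k
    simp only [hL, Matrix.vecMul_sub, Matrix.vecMul_diagonal, Pi.sub_apply, Pi.zero_apply] at this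
    simp only [Matrix.vecMul, dotProduct, Matrix.of_apply] at this
    linarith
  have hle : ∀ k, |v k| * ∑ i, G.weight k i ≤ ∑ i, |v i| * G.weight i k := by
    intro k
    have h0 : 0 ≤ ∑ i, G.weight k i := Finset.sum_nonneg fun i _ => G.weight_nonneg k i
    rw [← abs_of_nonneg h0, ← abs_mul, ← hv' k]
    refine (Finset.abs_sum_le_sum_abs _ _).trans (Finset.sum_le_sum fun i _ => ?_)
    rw [abs_mul, abs_of_nonneg (G.weight_nonneg i k)]
  have htot : ∑ k, |v k| * ∑ i, G.weight k i = ∑ k, ∑ i, |v i| * G.weight i k := by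
    rw [Finset.sum_comm]
    simp_rw [Finset.mul_sum]
  have heq := (Finset.sum_eq_sum_iff_of_le fun k _ => hle k).1 htot
  refine ⟨fun i => |v i|, fun i => ?_, fun k => (heq k (Finset.mem_univ k)).symm⟩
  by_contra hi
  have hi0 : v i = 0 := by simpa using hi
  refine hv (funext fun j => ?_)
  refine hG.forall_of_exists (p := fun j => v j = 0) (fun a b hab ha => ?_) hi0 j
  have h1 := heq a (Finset.mem_univ a)
  rw [ha, abs_zero, zero_mul] at h1
  have h2 := (Finset.sum_eq_zero_iff_of_nonneg
    (fun m _ => mul_nonneg (abs_nonneg (v m)) (G.weight_nonneg m a))).1 h1.symm b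
    (Finset.mem_univ b)
  exact abs_eq_zero.1 ((mul_eq_zero.1 h2).resolve_right (G.weight_pos a b hab).ne')

/-- A continuous, positive, quadratically homogeneous function dominates a multiple of the squared
Euclidean norm. -/
theorem exists_mul_sum_sq_le {ι : Type*} [Fintype ι] {Q : (ι → ℝ) → ℝ} (hQ : Continuous Q)
    (hhom : ∀ (r : ℝ) x, Q (r • x) = r ^ 2 * Q x) (hpos : ∀ x, x ≠ 0 → 0 < Q x) :
    ∃ μ, 0 < μ ∧ ∀ x, μ * ∑ i, x i ^ 2 ≤ Q x := by
  by_cases hne : (Metric.sphere (0 : EuclideanSpace ℝ ι) 1).Nonempty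
  · have hc : Continuous fun x : EuclideanSpace ℝ ι => Q x.ofLp :=
      hQ.comp (PiLp.continuous_ofLp 2 _)
    obtain ⟨y, hy, hmin⟩ := (isCompact_sphere (0 : EuclideanSpace ℝ ι) 1).exists_isMinOn hne
      hc.continuousOn
    have hy0 : y ≠ 0 := by
      rintro rfl
      simp at hy
    refine ⟨Q y.ofLp, hpos _ fun h => hy0 (by ext i; simpa using congrFun h i), fun x => ?_⟩
    set x' : EuclideanSpace ℝ ι := WithLp.toLp 2 x with hx'
    have hn : ‖x'‖ ^ 2 = ∑ i, x i ^ 2 := by rw [EuclideanSpace.real_norm_sq_eq]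
    rw [← hn]
    by_cases hx : ‖x'‖ = 0
    · have : x = 0 := by
        funext i
        have := congrArg (fun v : EuclideanSpace ℝ ι => v i) (norm_eq_zero.1 hx)
        simpa [hx'] using this
      rw [hx, this]
      have := hhom 0 0
      simp at this
      simp [this]
    · have hmem : ‖x'‖⁻¹ • x' ∈ Metric.sphere (0 : EuclideanSpace ℝ ι) 1 := by
        simp [norm_smul, hx]
      have h1 : Q y.ofLp ≤ Q (‖x'‖⁻¹ • x) := hmin hmem
      have h2 : x = ‖x'‖ • ‖x'‖⁻¹ • x := by
        rw [smul_smul, mul_inv_cancel₀ hx, one_smul]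
      calc Q y.ofLp * ‖x'‖ ^ 2 ≤ Q (‖x'‖⁻¹ • x) * ‖x'‖ ^ 2 := by gcongr
        _ = Q x := by rw [mul_comm, ← hhom, ← h2]
  · refine ⟨1, one_pos, fun x => ?_⟩
    have hx : x = 0 := by
      by_contra hx
      refine hne ?_
      have : Nontrivial (EuclideanSpace ℝ ι) :=
        ⟨⟨WithLp.toLp 2 x, 0, fun h => hx (by
          funext i; simpa using congrArg (fun v : EuclideanSpace ℝ ι => v i) h)⟩⟩
      exact NormedSpace.sphere_nonempty.2 zero_le_one
    have := hhom 0 0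
    simp at this
    simp [hx, this]

/-- The pinned Laplacian form of a left null vector is a sum of squares over the edges. -/
theorem sum_pinned_form_eq {w : Fin N → ℝ}
    (hw : ∀ k, ∑ i, w i * G.weight i k = w k * ∑ i, G.weight k i) (j : Fin N) (x : Fin N → ℝ) :
    2 * ∑ i, w i * x i * (∑ k, G.weight i k * (x i - x k) + G.weight i j * x i) =
      ∑ i, ∑ k, w i * G.weight i k * (x i - x k) ^ 2 + 2 * ∑ i, w i * G.weight i j * x i ^ 2 := by
  have h1 : ∑ i, ∑ k, w i * G.weight i k * x k ^ 2 =
      ∑ i, ∑ k, w i * G.weight i k * x i ^ 2 := by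
    rw [Finset.sum_comm]
    refine Finset.sum_congr rfl fun k _ => ?_
    rw [← Finset.sum_mul, hw k, Finset.mul_sum, Finset.sum_mul]
  have h2 : ∑ i, ∑ k, w i * G.weight i k * (x i - x k) ^ 2 =
      2 * ∑ i, ∑ k, w i * x i * (G.weight i k * (x i - x k)) := by
    have : ∀ i k, w i * G.weight i k * (x i - x k) ^ 2 =
        2 * (w i * x i * (G.weight i k * (x i - x k))) +
          (w i * G.weight i k * x k ^ 2 - w i * G.weight i k * x i ^ 2) := fun i k => by ring
    simp_rw [this, Finset.sum_add_distrib, Finset.sum_sub_distrib, h1, ← Finset.mul_sum]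
    ring
  rw [h2, ← mul_add, ← Finset.sum_add_distrib]
  congr 1
  refine Finset.sum_congr rfl fun i _ => ?_
  rw [mul_add, Finset.mul_sum]
  ring

/-- The pinned Laplacians are positive definite in the metric given by a positive left null vector,
uniformly in the pinned node: each leader `j` has an out-neighbour, from which all nodes are
reached. -/
theorem CommGraph.StronglyConnected.exists_pinned_form_lower_bound (hG : G.StronglyConnected)
    (hN : 1 < N) {w : Fin N → ℝ} (hw0 : ∀ i, 0 < w i)
    (hw : ∀ k, ∑ i, w i * G.weight i k = w k * ∑ i, G.weight k i) :
    ∃ μ, 0 < μ ∧ ∀ (j : Fin N) (x : Fin N → ℝ), μ * ∑ i, x i ^ 2 ≤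
      ∑ i, w i * x i * (∑ k, G.weight i k * (x i - x k) + G.weight i j * x i) := by
  have hj : ∀ j, ∃ μ, 0 < μ ∧ ∀ x : Fin N → ℝ, μ * ∑ i, x i ^ 2 ≤
      ∑ i, w i * x i * (∑ k, G.weight i k * (x i - x k) + G.weight i j * x i) := by
    intro j
    refine exists_mul_sum_sq_le (by fun_prop) (fun r x => ?_) fun x hx => ?_
    · rw [Finset.mul_sum]
      refine Finset.sum_congr rfl fun i _ => ?_
      simp only [Pi.smul_apply, smul_eq_mul]
      have : ∑ k, G.weight i k * (r * x i - r * x k) =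
          r * ∑ k, G.weight i k * (x i - x k) := by
        rw [Finset.mul_sum]
        exact Finset.sum_congr rfl fun k _ => by ring
      rw [this]
      ring
    · by_contra hcon
      push Not at hcon
      have e := sum_pinned_form_eq hw j x
      have n1 : ∀ i k, 0 ≤ w i * G.weight i k * (x i - x k) ^ 2 := fun i k =>
        mul_nonneg (mul_nonneg (hw0 i).le (G.weight_nonneg i k)) (sq_nonneg _)
      have n2 : ∀ i, 0 ≤ w i * G.weight i j * x i ^ 2 := fun i =>
        mul_nonneg (mul_nonneg (hw0 i).le (G.weight_nonneg i j)) (sq_nonneg _)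
      have s1 : 0 ≤ ∑ i, ∑ k, w i * G.weight i k * (x i - x k) ^ 2 :=
        Finset.sum_nonneg fun i _ => Finset.sum_nonneg fun k _ => n1 i k
      have s2 : 0 ≤ ∑ i, w i * G.weight i j * x i ^ 2 := Finset.sum_nonneg fun i _ => n2 i
      have z1 : ∑ i, ∑ k, w i * G.weight i k * (x i - x k) ^ 2 = 0 := by linarith
      have z2 : ∑ i, w i * G.weight i j * x i ^ 2 = 0 := by linarith
      have z1' : ∀ i k, G.Adj k i → x i = x k := by
        intro i k hik
        have h := (Finset.sum_eq_zero_iff_of_nonneg (fun i _ =>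
          Finset.sum_nonneg fun k _ => n1 i k)).1 z1 i (Finset.mem_univ i)
        have h' := (Finset.sum_eq_zero_iff_of_nonneg (fun k _ => n1 i k)).1 h k (Finset.mem_univ k)
        have hne : w i * G.weight i k ≠ 0 := (mul_pos (hw0 i) (G.weight_pos k i hik)).ne'
        exact sub_eq_zero.1 (pow_eq_zero_iff two_ne_zero |>.1 ((mul_eq_zero.1 h').resolve_left hne))
      obtain ⟨i, hi⟩ : ∃ i, G.Adj j i := by
        have : Nontrivial (Fin N) := Fin.nontrivial_iff_two_le.2 hN
        obtain ⟨m, hm⟩ := exists_ne j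
        obtain ⟨b, hb, -⟩ := Relation.TransGen.head'_iff.1 (hG j m hm.symm)
        exact ⟨b, hb⟩
      have hxi : x i = 0 := by
        have h := (Finset.sum_eq_zero_iff_of_nonneg (fun i _ => n2 i)).1 z2 i (Finset.mem_univ i)
        have hne : w i * G.weight i j ≠ 0 := (mul_pos (hw0 i) (G.weight_pos j i hi)).ne'
        exact pow_eq_zero_iff two_ne_zero |>.1 ((mul_eq_zero.1 h).resolve_left hne)
      exact hx (funext fun k => hG.forall_of_exists (p := fun k => x k = 0)
        (fun a b hab ha => (z1' b a hab).trans ha) hxi k)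
  choose μ hμ hμle using hj
  have : Nonempty (Fin N) := ⟨⟨0, by omega⟩⟩
  obtain ⟨j₀, hj₀⟩ := Finite.exists_min μ
  refine ⟨μ j₀, hμ j₀, fun j x => le_trans ?_ (hμle j x)⟩
  exact mul_le_mul_of_nonneg_right (hj₀ j) (Finset.sum_nonneg fun i _ => sq_nonneg _)

end Graph

/-! ### The Lyapunov function and its dissipation inequality -/

section Dissipation

variable {N : ℕ} {G : CommGraph N} {f : Fin N → EuclideanSpace ℝ (Fin N) → ℝ}

/-- The disagreement `ξ_{ij}` as a function of the reference signals `η` (which stand for the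
negated gradient integrals) and of the estimates `z`. It is linear in `(η, z)`. -/
noncomputable def localError (G : CommGraph N) (η : Fin N → ℝ) (z : Fin N → Fin N → ℝ)
    (i j : Fin N) : ℝ :=
  (∑ k, G.weight i k * (z i j - z k j)) + G.weight i j * (z i j - η j)

/-- The negated velocity `(c_{ij} + ξ_{ij}²) ξ_{ij}` of the estimates. -/
noncomputable def correction (ξ c : Fin N → Fin N → ℝ) (i j : Fin N) : ℝ :=
  (c i j + ξ i j ^ 2) * ξ i j

/-- The part of the Lyapunov function that vanishes at the equilibrium whatever the gains: the
distance of the reference signals to `y*`, and the disagreements weighted by a left null vector `w`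
of the Laplacian. -/
noncomputable def errorEnergy (κ : ℝ) (w : Fin N → ℝ) (y : EuclideanSpace ℝ (Fin N))
    (η : Fin N → ℝ) (ξ c : Fin N → Fin N → ℝ) : ℝ :=
  κ / 2 * ∑ j, (η j - y j) ^ 2 + ∑ j, ∑ i, w i * ((c i j + ξ i j ^ 2 / 2) * ξ i j ^ 2)

/-- The part of the Lyapunov function that penalizes the deviation of the adaptive gains from a
sufficiently large constant `α`. -/
noncomputable def gainEnergy (α : ℝ) (w : Fin N → ℝ) (c : Fin N → Fin N → ℝ) : ℝ :=
  1 / 2 * ∑ j, ∑ i, w i * (c i j - α) ^ 2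

/-- The derivative of `errorEnergy + gainEnergy` along the closed loop with reference velocity
`-γ`. -/
noncomputable def lyapunovRate (G : CommGraph N) (κ α : ℝ) (w : Fin N → ℝ)
    (y : EuclideanSpace ℝ (Fin N)) (η γ : Fin N → ℝ) (ξ c : Fin N → Fin N → ℝ) : ℝ :=
  κ * ∑ j, (η j - y j) * -γ j + ∑ j, ∑ i, w i * (ξ i j ^ 4 + 2 * correction ξ c i j *
    localError G (fun j => -γ j) (fun i j => -correction ξ c i j) i j) +
    ∑ j, ∑ i, w i * ((c i j - α) * ξ i j ^ 2)

theorem localError_eq (η : Fin N → ℝ) (z : Fin N → Fin N → ℝ) (i j : Fin N) :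
    localError G η z i j =
      ∑ k, G.weight i k * ((z i j - η j) - (z k j - η j)) + G.weight i j * (z i j - η j) := by
  simp [localError]

/-- The tracking errors are controlled by the disagreements. -/
theorem sum_sq_tracking_le {w : Fin N → ℝ} {μ : ℝ} (hμ : 0 < μ)
    (hform : ∀ (j : Fin N) (x : Fin N → ℝ), μ * ∑ i, x i ^ 2 ≤
      ∑ i, w i * x i * (∑ k, G.weight i k * (x i - x k) + G.weight i j * x i))
    (η : Fin N → ℝ) (z : Fin N → Fin N → ℝ) :
    ∑ j, ∑ i, (z i j - η j) ^ 2 ≤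
      (∑ i, w i ^ 2) / μ ^ 2 * ∑ j, ∑ i, localError G η z i j ^ 2 := by
  rw [Finset.mul_sum]
  refine Finset.sum_le_sum fun j _ => ?_
  have h := hform j fun i => z i j - η j
  simp_rw [← localError_eq] at h
  have h2 : ∑ i, w i * (z i j - η j) * localError G η z i j ≤
      ∑ i, (μ / 2 * (z i j - η j) ^ 2 +
        (∑ i, w i ^ 2) / (2 * μ) * localError G η z i j ^ 2) := by
    refine Finset.sum_le_sum fun i _ => ?_
    have hw : w i ^ 2 ≤ ∑ i, w i ^ 2 :=
      Finset.single_le_sum (f := fun i => w i ^ 2) (fun i _ => sq_nonneg _) (Finset.mem_univ i)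
    have h3 : w i ^ 2 / (2 * μ) * localError G η z i j ^ 2 ≤
        (∑ i, w i ^ 2) / (2 * μ) * localError G η z i j ^ 2 := by gcongr
    have h4 : μ / 2 * (z i j - η j) ^ 2 + w i ^ 2 / (2 * μ) * localError G η z i j ^ 2 -
        w i * (z i j - η j) * localError G η z i j =
        (μ * (z i j - η j) - w i * localError G η z i j) ^ 2 / (2 * μ) := by
      field_simp
      ring
    have h5 : 0 ≤ (μ * (z i j - η j) - w i * localError G η z i j) ^ 2 / (2 * μ) := by positivity
    linarith
  rw [Finset.sum_add_distrib, ← Finset.mul_sum, ← Finset.mul_sum] at h2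
  have h3 : μ / 2 * ∑ i, (z i j - η j) ^ 2 ≤
      (∑ i, w i ^ 2) / (2 * μ) * ∑ i, localError G η z i j ^ 2 := by linarith
  calc ∑ i, (z i j - η j) ^ 2 = 2 / μ * (μ / 2 * ∑ i, (z i j - η j) ^ 2) := by field_simp
    _ ≤ 2 / μ * ((∑ i, w i ^ 2) / (2 * μ) * ∑ i, localError G η z i j ^ 2) := by gcongr
    _ = _ := by field_simp

/-- The consensus part of the Lyapunov rate for the estimates of the `j`-th reference signal. The
terms `ξ⁴` and `c ξ²` combine to `correction · ξ`, which the quadratic form of the correction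
absorbs up to a multiple of `ξ²` that does not depend on the size of the gains. -/
theorem sum_consensus_rate_le {w : Fin N → ℝ} {μ m α : ℝ} (hμ : 0 < μ)
    (hform : ∀ (j : Fin N) (x : Fin N → ℝ), μ * ∑ i, x i ^ 2 ≤
      ∑ i, w i * x i * (∑ k, G.weight i k * (x i - x k) + G.weight i j * x i))
    (hm : ∀ i, m ≤ w i) (hα : 0 ≤ α) (γ : Fin N → ℝ) (ξ c : Fin N → Fin N → ℝ) (j : Fin N) :
    ∑ i, w i * (ξ i j ^ 4 + 2 * correction ξ c i j *
        localError G (fun j => -γ j) (fun i j => -correction ξ c i j) i j) +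
      ∑ i, w i * ((c i j - α) * ξ i j ^ 2) ≤
      (∑ j, ∑ i, (w i * G.weight i j) ^ 2 / μ) * γ j ^ 2 +
        ((∑ i, w i ^ 2) / (4 * μ) - α * m) * ∑ i, ξ i j ^ 2 := by
  set s : Fin N → ℝ := fun i => correction ξ c i j with hs
  have h := hform j s
  have hle : ∀ i, localError G (fun j => -γ j) (fun i j => -correction ξ c i j) i j =
      -(∑ k, G.weight i k * (s i - s k) + G.weight i j * s i) + G.weight i j * γ j := by
    intro i
    have : ∑ k, G.weight i k * (-correction ξ c i j - -correction ξ c k j) =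
        -∑ k, G.weight i k * (s i - s k) := by
      rw [← Finset.sum_neg_distrib]
      exact Finset.sum_congr rfl fun k _ => by simp only [hs]; ring
    rw [localError, this]
    simp only [hs]
    ring
  have hterm : ∀ i, w i * (ξ i j ^ 4 + 2 * correction ξ c i j *
        localError G (fun j => -γ j) (fun i j => -correction ξ c i j) i j) +
      w i * ((c i j - α) * ξ i j ^ 2) ≤
      -2 * (w i * s i * (∑ k, G.weight i k * (s i - s k) + G.weight i j * s i)) +
        2 * μ * s i ^ 2 + (w i * G.weight i j) ^ 2 / μ * γ j ^ 2 +
        ((∑ i, w i ^ 2) / (4 * μ) - α * m) * ξ i j ^ 2 := by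
    intro i
    rw [hle i]
    have e1 : w i * ξ i j ^ 4 + w i * (c i j * ξ i j ^ 2) = w i * s i * ξ i j := by
      simp only [hs, correction]; ring
    have e2 : 2 * (w i * s i * (G.weight i j * γ j)) ≤
        μ * s i ^ 2 + (w i * G.weight i j) ^ 2 / μ * γ j ^ 2 := by
      have : μ * s i ^ 2 + (w i * G.weight i j) ^ 2 / μ * γ j ^ 2 -
          2 * (w i * s i * (G.weight i j * γ j)) =
          (μ * s i - w i * G.weight i j * γ j) ^ 2 / μ := by
        field_simp; ring
      have h5 : 0 ≤ (μ * s i - w i * G.weight i j * γ j) ^ 2 / μ := by positivity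
      linarith
    have e3 : w i * s i * ξ i j ≤ μ * s i ^ 2 + (∑ i, w i ^ 2) / (4 * μ) * ξ i j ^ 2 := by
      have hw : w i ^ 2 ≤ ∑ i, w i ^ 2 :=
        Finset.single_le_sum (f := fun i => w i ^ 2) (fun i _ => sq_nonneg _) (Finset.mem_univ i)
      have h3 : w i ^ 2 / (4 * μ) * ξ i j ^ 2 ≤ (∑ i, w i ^ 2) / (4 * μ) * ξ i j ^ 2 := by gcongr
      have : μ * s i ^ 2 + w i ^ 2 / (4 * μ) * ξ i j ^ 2 - w i * s i * ξ i j =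
          (2 * μ * s i - w i * ξ i j) ^ 2 / (4 * μ) := by
        field_simp; ring
      have h5 : 0 ≤ (2 * μ * s i - w i * ξ i j) ^ 2 / (4 * μ) := by positivity
      linarith
    have e4 : α * m * ξ i j ^ 2 ≤ α * w i * ξ i j ^ 2 := by
      have := hm i
      gcongr
    have e5 : s i = correction ξ c i j := rfl
    rw [← e5]
    nlinarith
  rw [← Finset.sum_add_distrib]
  refine (Finset.sum_le_sum fun i _ => hterm i).trans ?_
  rw [Finset.sum_add_distrib, Finset.sum_add_distrib, Finset.sum_add_distrib, ← Finset.mul_sum,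
    ← Finset.mul_sum, ← Finset.sum_mul, ← Finset.mul_sum]
  have hB : ∑ i, (w i * G.weight i j) ^ 2 / μ ≤ ∑ j, ∑ i, (w i * G.weight i j) ^ 2 / μ :=
    Finset.single_le_sum (f := fun j => ∑ i, (w i * G.weight i j) ^ 2 / μ)
      (fun j _ => Finset.sum_nonneg fun i _ => by positivity) (Finset.mem_univ j)
  have := mul_le_mul_of_nonneg_right hB (sq_nonneg (γ j))
  nlinarith

/-- Each player's gradient, evaluated at its own estimates, is close to the gradient at the
references. -/
theorem sum_sq_partialGrad_le {l : Fin N → ℝ}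
    (hlip : ∀ (i : Fin N) (y z : EuclideanSpace ℝ (Fin N)),
      |partialGrad f i y - partialGrad f i z| ≤ l i * ‖y - z‖)
    (η : EuclideanSpace ℝ (Fin N)) (z : Fin N → EuclideanSpace ℝ (Fin N)) :
    ∑ j, (partialGrad f j (z j) - partialGrad f j η) ^ 2 ≤
      (∑ j, l j ^ 2) * ∑ k, ∑ j, (z j k - η k) ^ 2 := by
  rw [Finset.sum_comm, Finset.sum_mul]
  refine Finset.sum_le_sum fun j _ => ?_
  have h1 : (partialGrad f j (z j) - partialGrad f j η) ^ 2 ≤ (l j * ‖z j - η‖) ^ 2 := by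
    rw [← sq_abs]
    exact pow_le_pow_left₀ (abs_nonneg _) (hlip j _ _) 2
  have h2 : ‖z j - η‖ ^ 2 = ∑ k, (z j k - η k) ^ 2 := by
    rw [EuclideanSpace.real_norm_sq_eq]
    simp
  have h3 : ∑ k, (z j k - η k) ^ 2 ≤ ∑ j, ∑ k, (z j k - η k) ^ 2 :=
    Finset.single_le_sum (f := fun j => ∑ k, (z j k - η k) ^ 2)
      (fun j _ => Finset.sum_nonneg fun k _ => sq_nonneg _) (Finset.mem_univ j)
  calc _ ≤ _ := h1
    _ = l j ^ 2 * ∑ k, (z j k - η k) ^ 2 := by rw [mul_pow, h2]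
    _ ≤ _ := by gcongr

/-- Along the closed loop, the Lyapunov function decreases at least at the rate given by the squared
distance of the references to the equilibrium plus the squared disagreements. The weight `κ` of the
optimization error is chosen first, to dominate the drift that the references impose on the
estimates; the gain target `α` then dominates the estimation errors. -/
theorem exists_lyapunovRate_le (hf : SmoothLipschitz f) (hmono : StronglyMonotone f)
    (hN : 1 < N) {w : Fin N → ℝ} {μ : ℝ} (hμ : 0 < μ) (hw0 : ∀ i, 0 < w i)
    (hform : ∀ (j : Fin N) (x : Fin N → ℝ), μ * ∑ i, x i ^ 2 ≤
      ∑ i, w i * x i * (∑ k, G.weight i k * (x i - x k) + G.weight i j * x i))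
    {y : EuclideanSpace ℝ (Fin N)} (hy : ∀ i, partialGrad f i y = 0) :
    ∃ κ α : ℝ, 0 < κ ∧ ∀ (η : EuclideanSpace ℝ (Fin N)) (z : Fin N → EuclideanSpace ℝ (Fin N))
      (c : Fin N → Fin N → ℝ),
      lyapunovRate G κ α w y η (fun j => partialGrad f j (z j))
        (localError G η fun i j => z i j) c ≤
      -(∑ j, (η j - y j) ^ 2 + ∑ j, ∑ i, localError G η (fun i j => z i j) i j ^ 2) := by
  obtain ⟨-, l, hl, hlip⟩ := hf
  obtain ⟨ω, hω, hm⟩ := hmono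
  have : Nonempty (Fin N) := ⟨⟨0, by omega⟩⟩
  obtain ⟨i₀, hi₀⟩ := Finite.exists_min w
  set m := w i₀ with hmdef
  have hm0 : 0 < m := hw0 i₀
  set S : ℝ := ∑ j, l j ^ 2 with hS
  have hS0 : 0 ≤ S := Finset.sum_nonneg fun i _ => sq_nonneg _
  set B : ℝ := ∑ j, ∑ i, (w i * G.weight i j) ^ 2 / μ with hB
  have hB0 : 0 ≤ B := Finset.sum_nonneg fun j _ => Finset.sum_nonneg fun i _ => by positivity
  set W : ℝ := ∑ i, w i ^ 2 with hW
  have hW0 : 0 ≤ W := Finset.sum_nonneg fun i _ => sq_nonneg _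
  set κ : ℝ := 2 / ω * (1 + 2 * N * B * S) with hκ
  have hκ0 : 0 < κ := by positivity
  set α : ℝ := (1 + W / (4 * μ) + W / μ ^ 2 * (κ * S / (2 * ω) + 2 * B * S)) / m with hα
  have hα0 : 0 ≤ α := by positivity
  refine ⟨κ, α, hκ0, fun η z c => ?_⟩
  set ξ : Fin N → Fin N → ℝ := localError G η fun i j => z i j with hξ
  set γ : Fin N → ℝ := fun j => partialGrad f j (z j) with hγ
  set D : ℝ := ∑ j, (η j - y j) ^ 2 with hD
  set X : ℝ := ∑ j, ∑ i, ξ i j ^ 2 with hX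
  set E : ℝ := ∑ j, ∑ i, (z i j - η j) ^ 2 with hE
  have hEX : E ≤ W / μ ^ 2 * X := sum_sq_tracking_le hμ hform η fun i j => z i j
  -- the drift of the references
  have hγ2 : ∑ j, γ j ^ 2 ≤ S * (2 * E + 2 * N * D) := by
    have h1 := sum_sq_partialGrad_le hlip y z
    simp only [hy, sub_zero] at h1
    refine h1.trans (mul_le_mul_of_nonneg_left ?_ hS0)
    have h2 : ∑ k, ∑ j, (z j k - y k) ^ 2 ≤
        ∑ k, ∑ j : Fin N, (2 * (z j k - η k) ^ 2 + 2 * (η k - y k) ^ 2) :=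
      Finset.sum_le_sum fun k _ => Finset.sum_le_sum fun j _ => by
        nlinarith [sq_nonneg ((z j k - η k) - (η k - y k))]
    refine h2.trans (le_of_eq ?_)
    simp_rw [Finset.sum_add_distrib, ← Finset.mul_sum, Finset.sum_const, Finset.card_univ,
      Fintype.card_fin, nsmul_eq_mul, ← Finset.mul_sum]
    rw [hE, hD]
    ring
  -- the optimization error
  have hopt : κ * ∑ j, (η j - y j) * -γ j ≤ κ * (-(ω / 2) * D + S / (2 * ω) * E) := by
    refine mul_le_mul_of_nonneg_left ?_ hκ0.le
    have h1 := hm η y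
    have h2 : ‖η - y‖ ^ 2 = D := by
      rw [EuclideanSpace.real_norm_sq_eq]
      simp [hD]
    rw [h2] at h1
    simp only [hy, sub_zero] at h1
    have h3 := sum_sq_partialGrad_le hlip η z
    have h4 : ∑ j, (η j - y j) * -γ j ≤ ∑ j, (-((η j - y j) * partialGrad f j η) +
        (ω / 2 * (η j - y j) ^ 2 + 1 / (2 * ω) * (γ j - partialGrad f j η) ^ 2)) := by
      refine Finset.sum_le_sum fun j _ => ?_
      have e : ω / 2 * (η j - y j) ^ 2 + 1 / (2 * ω) * (γ j - partialGrad f j η) ^ 2 +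
          (η j - y j) * (γ j - partialGrad f j η) =
          (ω * (η j - y j) + (γ j - partialGrad f j η)) ^ 2 / (2 * ω) := by
        field_simp; ring
      have e' : 0 ≤ (ω * (η j - y j) + (γ j - partialGrad f j η)) ^ 2 / (2 * ω) := by positivity
      linarith
    rw [Finset.sum_add_distrib, Finset.sum_add_distrib, Finset.sum_neg_distrib, ← Finset.mul_sum,
      ← Finset.mul_sum] at h4
    have h5 : 1 / (2 * ω) * ∑ j, (γ j - partialGrad f j η) ^ 2 ≤ 1 / (2 * ω) * (S * E) := by
      gcongr
    have h6 : S / (2 * ω) * E = 1 / (2 * ω) * (S * E) := by ring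
    rw [h6]
    linarith
  -- the estimation errors
  have hcons : ∑ j, ∑ i, w i * (ξ i j ^ 4 + 2 * correction ξ c i j *
        localError G (fun j => -γ j) (fun i j => -correction ξ c i j) i j) +
      ∑ j, ∑ i, w i * ((c i j - α) * ξ i j ^ 2) ≤
      B * ∑ j, γ j ^ 2 + (W / (4 * μ) - α * m) * X := by
    rw [← Finset.sum_add_distrib, hX, Finset.mul_sum, Finset.mul_sum, ← Finset.sum_add_distrib]
    exact Finset.sum_le_sum fun j _ => sum_consensus_rate_le hμ hform hi₀ hα0 γ ξ c j
  have hBγ : B * ∑ j, γ j ^ 2 ≤ B * (S * (2 * E + 2 * N * D)) := by gcongr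
  have hαm : α * m = 1 + W / (4 * μ) + W / μ ^ 2 * (κ * S / (2 * ω) + 2 * B * S) :=
    div_mul_cancel₀ _ hm0.ne'
  have hκω : κ * (ω / 2) = 1 + 2 * N * B * S := by
    rw [hκ]; field_simp
  have hE' : (κ * S / (2 * ω) + 2 * B * S) * E ≤
      (κ * S / (2 * ω) + 2 * B * S) * (W / μ ^ 2 * X) := by gcongr
  have e1 : κ * (-(ω / 2) * D + S / (2 * ω) * E) =
      -(1 + 2 * N * B * S) * D + κ * S / (2 * ω) * E := by
    rw [← hκω]; ring
  rw [e1] at hopt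
  rw [hαm] at hcons
  have e2 : lyapunovRate G κ α w y η γ ξ c = κ * ∑ j, (η j - y j) * -γ j +
      (∑ j, ∑ i, w i * (ξ i j ^ 4 + 2 * correction ξ c i j *
        localError G (fun j => -γ j) (fun i j => -correction ξ c i j) i j) +
      ∑ j, ∑ i, w i * ((c i j - α) * ξ i j ^ 2)) := by
    rw [lyapunovRate, add_assoc]
  rw [e2]
  linarith

end Dissipation

/-! ### Real functions on a half-line -/

section HalfLine

theorem boundedConvergent_of_continuousOn {g : ℝ → ℝ} {L : ℝ} (hc : ContinuousOn g (Set.Ici 0))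
    (hL : Tendsto g atTop (𝓝 L)) : BoundedConvergent g := by
  refine ⟨?_, L, hL⟩
  obtain ⟨T, hT⟩ := eventually_atTop.1 (hL.abs.eventually (ge_mem_nhds (lt_add_one |L|)))
  obtain ⟨M, hM⟩ := isCompact_Icc.exists_bound_of_continuousOn
    (hc.mono (Set.Icc_subset_Ici_self : Set.Icc 0 T ⊆ Set.Ici 0))
  refine ⟨max M (|L| + 1), fun t ht => ?_⟩
  rcases le_total T t with h | h
  · exact (hT t h).trans (le_max_right _ _)
  · exact (hM t ⟨ht, h⟩).trans (le_max_left _ _)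

theorem exists_tendsto_of_monotoneOn_Ici {g : ℝ → ℝ} {M : ℝ} (hg : MonotoneOn g (Set.Ici 0))
    (hM : ∀ t, 0 ≤ t → g t ≤ M) : ∃ L, Tendsto g atTop (𝓝 L) := by
  have hmono : Monotone fun t => g (max t 0) := fun s t hst =>
    hg (Set.mem_Ici.2 (le_max_right _ _)) (Set.mem_Ici.2 (le_max_right _ _))
      (max_le_max_right 0 hst)
  have hb : BddAbove (Set.range fun t => g (max t 0)) :=
    ⟨M, by rintro _ ⟨t, rfl⟩; exact hM _ (le_max_right _ _)⟩
  refine ⟨_, (tendsto_atTop_ciSup hmono hb).congr' ?_⟩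
  filter_upwards [eventually_ge_atTop 0] with t ht
  rw [max_eq_left ht]

theorem exists_lt_of_deriv_le_neg {g g' : ℝ → ℝ} {T δ : ℝ} (hδ : 0 < δ)
    (hg : ∀ t, T ≤ t → HasDerivWithinAt g (g' t) (Set.Ici T) t)
    (hg' : ∀ t, T ≤ t → g' t ≤ -δ) (B : ℝ) : ∃ t, T ≤ t ∧ g t < B := by
  have hanti : AntitoneOn (fun t => g t + δ * t) (Set.Ici T) := by
    have hd : ∀ t, T ≤ t → HasDerivWithinAt (fun t => g t + δ * t) (g' t + δ * 1) (Set.Ici T) t :=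
      fun t ht => (hg t ht).add ((hasDerivWithinAt_id t _).const_mul δ)
    refine antitoneOn_of_hasDerivWithinAt_nonpos (convex_Ici T)
      (fun t ht => (hd t ht).continuousWithinAt)
      (fun t ht => (hd t (interior_subset ht)).mono interior_subset) fun t ht => ?_
    have := hg' t (interior_subset ht)
    linarith
  set t := T + (|g T - B| + 1) / δ with ht
  have hTt : T ≤ t := by
    have : 0 ≤ (|g T - B| + 1) / δ := by positivity
    linarith
  refine ⟨t, hTt, ?_⟩
  have h := hanti (Set.self_mem_Ici) hTt hTt
  have h2 : δ * t = δ * T + (|g T - B| + 1) := by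
    rw [ht]; field_simp
  simp only [h2] at h
  have := le_abs_self (g T - B)
  linarith

/-- A function that decreases at a definite rate whenever it is at least `B` is eventually at most
`B`. -/
theorem eventually_le_of_deriv_le_neg {g g' : ℝ → ℝ} {T δ B : ℝ} (hδ : 0 < δ)
    (hg : ∀ t, T ≤ t → HasDerivWithinAt g (g' t) (Set.Ici T) t)
    (hg' : ∀ t, T ≤ t → B ≤ g t → g' t ≤ -δ) : ∀ᶠ t in atTop, g t ≤ B := by
  obtain ⟨t₁, ht₁, hB⟩ : ∃ t, T ≤ t ∧ g t ≤ B := by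
    by_contra! hcon
    obtain ⟨t, ht, htB⟩ := exists_lt_of_deriv_le_neg hδ hg
      (fun t ht => hg' t ht (hcon t ht).le) B
    exact (hcon t ht).not_gt htB
  filter_upwards [eventually_ge_atTop t₁] with t ht
  refine image_le_of_deriv_right_lt_deriv_boundary (a := t₁) (b := t) (f := g) (f' := g')
    (B := fun _ => B) (B' := fun _ => 0)
    (fun s hs => ((hg s (ht₁.trans hs.1)).continuousWithinAt).mono fun r hr => ht₁.trans hr.1)
    (fun s hs => (hg s (ht₁.trans hs.1)).mono fun r hr => (ht₁.trans hs.1).trans hr)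
    hB (fun s => hasDerivAt_const s B) (fun s hs hsB => ?_) ⟨ht, le_rfl⟩
  have := hg' s (ht₁.trans hs.1) hsB.ge
  linarith

theorem hasDerivWithinAt_integral_Ici {h : ℝ → ℝ} (hh : ContinuousOn h (Set.Ici 0)) {t : ℝ}
    (ht : 0 ≤ t) : HasDerivWithinAt (fun t => ∫ τ in (0 : ℝ)..t, h τ) (h t) (Set.Ici 0) t := by
  have hc : Continuous fun τ => h (max τ 0) :=
    hh.comp_continuous (by fun_prop) fun τ => Set.mem_Ici.2 (le_max_right _ _)
  have hd := (hc.integral_hasStrictDerivAt 0 t).hasDerivAt.hasDerivWithinAt (s := Set.Ici 0)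
  rw [max_eq_left ht] at hd
  have hcongr : ∀ s ∈ Set.Ici (0 : ℝ), ∫ τ in (0 : ℝ)..s, h τ = ∫ τ in (0 : ℝ)..s, h (max τ 0) := by
    intro s hs
    refine intervalIntegral.integral_congr fun τ hτ => ?_
    rw [Set.uIcc_of_le hs] at hτ
    simp only [max_eq_left hτ.1]
  exact hd.congr hcongr (hcongr t ht)

theorem tendsto_zero_of_sq {g : ℝ → ℝ} {l : Filter ℝ} (h : Tendsto (fun t => g t ^ 2) l (𝓝 0)) :
    Tendsto g l (𝓝 0) := by
  have h1 := (Real.continuous_sqrt.tendsto 0).comp h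
  rw [Real.sqrt_zero] at h1
  rw [tendsto_zero_iff_abs_tendsto_zero]
  exact h1.congr fun t => Real.sqrt_sq_eq_abs _

end HalfLine

/-! ### Convergence of the references, the estimates and the gains -/

section Convergence

variable {N : ℕ} {G : CommGraph N} {f : Fin N → EuclideanSpace ℝ (Fin N) → ℝ}

theorem hasDerivWithinAt_localError {η : ℝ → Fin N → ℝ} {z : ℝ → Fin N → Fin N → ℝ}
    {η' : Fin N → ℝ} {z' : Fin N → Fin N → ℝ} {s : Set ℝ} {t : ℝ}
    (hη : ∀ j, HasDerivWithinAt (fun t => η t j) (η' j) s t)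
    (hz : ∀ i j, HasDerivWithinAt (fun t => z t i j) (z' i j) s t) (i j : Fin N) :
    HasDerivWithinAt (fun t => localError G (η t) (z t) i j) (localError G η' z' i j) s t := by
  unfold localError
  exact (HasDerivWithinAt.fun_sum fun k _ => ((hz i j).fun_sub (hz k j)).const_mul _).fun_add
    (((hz i j).fun_sub (hη j)).const_mul _)

theorem hasDerivWithinAt_lyapunov (κ α : ℝ) (w : Fin N → ℝ) (y : EuclideanSpace ℝ (Fin N))
    {η : ℝ → Fin N → ℝ} {z c : ℝ → Fin N → Fin N → ℝ} {γ : Fin N → ℝ} {s : Set ℝ} {t : ℝ}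
    (hη : ∀ j, HasDerivWithinAt (fun t => η t j) (-γ j) s t)
    (hz : ∀ i j, HasDerivWithinAt (fun t => z t i j)
      (-correction (localError G (η t) (z t)) (c t) i j) s t)
    (hc : ∀ i j, HasDerivWithinAt (fun t => c t i j) (localError G (η t) (z t) i j ^ 2) s t) :
    HasDerivWithinAt
      (fun t => errorEnergy κ w y (η t) (localError G (η t) (z t)) (c t) + gainEnergy α w (c t))
      (lyapunovRate G κ α w y (η t) γ (localError G (η t) (z t)) (c t)) s t := by
  have hξ := hasDerivWithinAt_localError (G := G) hη hz
  have h1 : HasDerivWithinAt (fun t => κ / 2 * ∑ j, (η t j - y j) ^ 2)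
      (κ * ∑ j, (η t j - y j) * -γ j) s t := by
    refine ((HasDerivWithinAt.fun_sum fun j _ => ((hη j).sub_const (y j)).fun_pow 2).const_mul
      (κ / 2)).congr_deriv ?_
    rw [Finset.mul_sum, Finset.mul_sum]
    refine Finset.sum_congr rfl fun j _ => ?_
    push_cast
    ring
  have h2 : HasDerivWithinAt (fun t => ∑ j, ∑ i, w i * ((c t i j +
        localError G (η t) (z t) i j ^ 2 / 2) * localError G (η t) (z t) i j ^ 2))
      (∑ j, ∑ i, w i * (localError G (η t) (z t) i j ^ 4 +
        2 * correction (localError G (η t) (z t)) (c t) i j *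
        localError G (fun j => -γ j)
          (fun i j => -correction (localError G (η t) (z t)) (c t) i j) i j)) s t := by
    refine HasDerivWithinAt.fun_sum fun j _ => HasDerivWithinAt.fun_sum fun i _ => ?_
    refine ((((hc i j).fun_add (((hξ i j).fun_pow 2).div_const 2)).fun_mul
      ((hξ i j).fun_pow 2)).const_mul (w i)).congr_deriv ?_
    simp only [correction]
    push_cast
    ring
  have h3 : HasDerivWithinAt (fun t => 1 / 2 * ∑ j, ∑ i, w i * (c t i j - α) ^ 2)
      (∑ j, ∑ i, w i * ((c t i j - α) * localError G (η t) (z t) i j ^ 2)) s t := by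
    refine ((HasDerivWithinAt.fun_sum fun j _ => HasDerivWithinAt.fun_sum fun i _ =>
      (((hc i j).sub_const α).fun_pow 2).const_mul (w i)).const_mul (1 / 2)).congr_deriv ?_
    rw [Finset.mul_sum]
    refine Finset.sum_congr rfl fun j _ => ?_
    rw [Finset.mul_sum]
    refine Finset.sum_congr rfl fun i _ => ?_
    push_cast
    ring
  exact (h1.fun_add h2).fun_add h3

variable {κ α : ℝ} {w : Fin N → ℝ} {y : EuclideanSpace ℝ (Fin N)}

theorem le_sum_sum {ι : Type*} [Fintype ι] {F : ι → ι → ℝ} (hF : ∀ j i, 0 ≤ F j i) (j i : ι) :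
    F j i ≤ ∑ j, ∑ i, F j i :=
  (Finset.single_le_sum (f := fun i => F j i) (fun i _ => hF j i) (Finset.mem_univ i)).trans
    (Finset.single_le_sum (f := fun j => ∑ i, F j i)
      (fun j _ => Finset.sum_nonneg fun i _ => hF j i) (Finset.mem_univ j))

theorem le_errorEnergy (hκ : 0 < κ) (hw : ∀ i, 0 < w i) (η : Fin N → ℝ)
    {ξ c : Fin N → Fin N → ℝ} (hc : ∀ i j, 0 ≤ c i j) :
    (∀ j, κ / 2 * (η j - y j) ^ 2 ≤ errorEnergy κ w y η ξ c) ∧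
      ∀ i j, w i / 2 * (ξ i j ^ 2) ^ 2 ≤ errorEnergy κ w y η ξ c := by
  have n1 : ∀ j, 0 ≤ (η j - y j) ^ 2 := fun j => sq_nonneg _
  have n2 : ∀ j i, 0 ≤ w i * ((c i j + ξ i j ^ 2 / 2) * ξ i j ^ 2) := fun j i => by
    have := hw i
    have := hc i j
    positivity
  have s1 : 0 ≤ κ / 2 * ∑ j, (η j - y j) ^ 2 :=
    mul_nonneg (by positivity) (Finset.sum_nonneg fun j _ => n1 j)
  have s2 : 0 ≤ ∑ j, ∑ i, w i * ((c i j + ξ i j ^ 2 / 2) * ξ i j ^ 2) :=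
    Finset.sum_nonneg fun j _ => Finset.sum_nonneg fun i _ => n2 j i
  unfold errorEnergy
  refine ⟨fun j => ?_, fun i j => ?_⟩
  · have h1 : (η j - y j) ^ 2 ≤ ∑ j, (η j - y j) ^ 2 :=
      Finset.single_le_sum (fun j _ => n1 j) (Finset.mem_univ j)
    have h2 : κ / 2 * (η j - y j) ^ 2 ≤ κ / 2 * ∑ j, (η j - y j) ^ 2 := by gcongr
    linarith
  · have h1 := le_sum_sum n2 j i
    have h3 : 0 ≤ w i * (c i j * ξ i j ^ 2) := by
      have := hw i
      have := hc i j
      positivity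
    nlinarith

theorem errorEnergy_nonneg (hκ : 0 < κ) (hw : ∀ i, 0 < w i) (η : Fin N → ℝ)
    {ξ c : Fin N → Fin N → ℝ} (hc : ∀ i j, 0 ≤ c i j) : 0 ≤ errorEnergy κ w y η ξ c := by
  unfold errorEnergy
  refine add_nonneg (mul_nonneg (by positivity) (Finset.sum_nonneg fun j _ => sq_nonneg _))
    (Finset.sum_nonneg fun j _ => Finset.sum_nonneg fun i _ => ?_)
  have := hw i
  have := hc i j
  positivity

theorem le_gainEnergy (hw : ∀ i, 0 < w i) (c : Fin N → Fin N → ℝ) (i j : Fin N) :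
    w i / 2 * (c i j - α) ^ 2 ≤ gainEnergy α w c := by
  have n : ∀ j i, 0 ≤ w i * (c i j - α) ^ 2 := fun j i => mul_nonneg (hw i).le (sq_nonneg _)
  have h1 := le_sum_sum n j i
  unfold gainEnergy
  linarith

theorem gainEnergy_nonneg (hw : ∀ i, 0 < w i) (c : Fin N → Fin N → ℝ) :
    0 ≤ gainEnergy α w c :=
  mul_nonneg (by norm_num) (Finset.sum_nonneg fun j _ => Finset.sum_nonneg fun i _ =>
    mul_nonneg (hw i).le (sq_nonneg _))

theorem abs_le_one_add_sq (a : ℝ) : |a| ≤ 1 + a ^ 2 := by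
  rw [abs_le]
  constructor <;> nlinarith [sq_nonneg (a - 1), sq_nonneg (a + 1)]

/-- The sublevel sets of the Lyapunov function, over nonnegative gains, are bounded. -/
theorem exists_bound_of_lyapunov_le {μ : ℝ} (hμ : 0 < μ) (hκ : 0 < κ) (hw : ∀ i, 0 < w i)
    (hform : ∀ (j : Fin N) (x : Fin N → ℝ), μ * ∑ i, x i ^ 2 ≤
      ∑ i, w i * x i * (∑ k, G.weight i k * (x i - x k) + G.weight i j * x i))
    (M : ℝ) : ∃ R, 0 ≤ R ∧ ∀ (η : Fin N → ℝ) (z c : Fin N → Fin N → ℝ), (∀ i j, 0 ≤ c i j) →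
      errorEnergy κ w y η (localError G η z) c + gainEnergy α w c ≤ M →
      (∀ j, |η j| ≤ R) ∧ (∀ i j, |z i j| ≤ R) ∧ (∀ i j, |c i j| ≤ R) ∧
        ∀ i j, |localError G η z i j| ≤ R := by
  by_cases hM : 0 ≤ M
  swap
  · refine ⟨0, le_rfl, fun η z c hc hV => absurd ?_ hM⟩
    have h1 := errorEnergy_nonneg (y := y) (ξ := localError G η z) hκ hw η hc
    have h2 := gainEnergy_nonneg (α := α) hw c
    linarith
  have hpos : ∀ i, 0 ≤ 2 * M / w i := fun i => div_nonneg (by linarith) (hw i).le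
  set P : ℝ := ∑ i, 2 * M / w i with hP
  have hPi : ∀ i, 2 * M / w i ≤ P := fun i =>
    Finset.single_le_sum (f := fun i => 2 * M / w i) (fun i _ => hpos i) (Finset.mem_univ i)
  have hP0 : 0 ≤ P := Finset.sum_nonneg fun i _ => hpos i
  set Y : ℝ := ∑ j, |y j| with hY
  have hYj : ∀ j, |y j| ≤ Y := fun j =>
    Finset.single_le_sum (f := fun j => |y j|) (fun j _ => abs_nonneg _) (Finset.mem_univ j)
  have hY0 : 0 ≤ Y := Finset.sum_nonneg fun i _ => abs_nonneg _
  set C : ℝ := (∑ i, w i ^ 2) / μ ^ 2 with hC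
  have hC0 : 0 ≤ C := div_nonneg (Finset.sum_nonneg fun i _ => sq_nonneg _) (sq_nonneg _)
  set E : ℝ := C * (N * (N * (1 + P))) with hE
  have hE0 : 0 ≤ E := by positivity
  have hMκ : 0 ≤ 2 * M / κ := by positivity
  refine ⟨Y + 2 * M / κ + P + |α| + E + 2, by positivity, fun η z c hc hV => ?_⟩
  have hg0 := gainEnergy_nonneg (α := α) hw c
  have he0 := errorEnergy_nonneg (y := y) (ξ := localError G η z) hκ hw η hc
  obtain ⟨he1, he2⟩ := le_errorEnergy (y := y) (ξ := localError G η z) hκ hw η hc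
  have hηj : ∀ j, |η j| ≤ Y + 2 * M / κ + 1 := by
    intro j
    have h1 : (η j - y j) ^ 2 ≤ 2 * M / κ := by
      rw [le_div_iff₀ hκ]
      linarith [he1 j]
    have h2 := abs_le_one_add_sq (η j - y j)
    have h3 := abs_sub_abs_le_abs_sub (η j) (y j)
    linarith [hYj j]
  have hξ2 : ∀ i j, localError G η z i j ^ 2 ≤ 1 + P := by
    intro i j
    have h1 : (localError G η z i j ^ 2) ^ 2 ≤ 2 * M / w i := by
      rw [le_div_iff₀ (hw i)]
      linarith [he2 i j]
    have h2 := abs_le_one_add_sq (localError G η z i j ^ 2)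
    have h3 := le_abs_self (localError G η z i j ^ 2)
    linarith [hPi i]
  refine ⟨fun j => ?_, fun i j => ?_, fun i j => ?_, fun i j => ?_⟩
  · linarith [hηj j, abs_nonneg α]
  · have h1 := sum_sq_tracking_le hμ hform η z
    have h2 : (z i j - η j) ^ 2 ≤ ∑ j, ∑ i, (z i j - η j) ^ 2 :=
      le_sum_sum (F := fun j i => (z i j - η j) ^ 2) (fun j i => sq_nonneg _) j i
    have h3 : ∑ j, ∑ i, localError G η z i j ^ 2 ≤ N * (N * (1 + P)) := by
      refine (Finset.sum_le_sum fun j _ => Finset.sum_le_sum fun i _ => hξ2 i j).trans ?_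
      simp only [Finset.sum_const, Finset.card_univ, Fintype.card_fin, nsmul_eq_mul, le_refl]
    have h4 : C * ∑ j, ∑ i, localError G η z i j ^ 2 ≤ E := mul_le_mul_of_nonneg_left h3 hC0
    have h5 := abs_le_one_add_sq (z i j - η j)
    have h6 := abs_sub_abs_le_abs_sub (z i j) (η j)
    linarith [hηj j, abs_nonneg α]
  · have h1 : (c i j - α) ^ 2 ≤ 2 * M / w i := by
      rw [le_div_iff₀ (hw i)]
      linarith [le_gainEnergy (α := α) hw c i j]
    have h2 := abs_le_one_add_sq (c i j - α)
    have h3 := abs_sub_abs_le_abs_sub (c i j) α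
    linarith [hPi i]
  · have h2 := abs_le_one_add_sq (localError G η z i j)
    linarith [hξ2 i j, abs_nonneg α]

/-- With bounded gains and disagreements, the error energy is dominated by the dissipation. -/
theorem exists_errorEnergy_le (hκ : 0 < κ) (hw : ∀ i, 0 < w i) {R : ℝ} (hR : 0 ≤ R) :
    ∃ K, 0 < K ∧ ∀ (η : Fin N → ℝ) (ξ c : Fin N → Fin N → ℝ), (∀ i j, |c i j| ≤ R) →
      (∀ i j, |ξ i j| ≤ R) →
      errorEnergy κ w y η ξ c ≤ K * (∑ j, (η j - y j) ^ 2 + ∑ j, ∑ i, ξ i j ^ 2) := by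
  have hS : 0 ≤ ∑ i, w i := Finset.sum_nonneg fun i _ => (hw i).le
  refine ⟨κ / 2 + (∑ i, w i) * (R + R ^ 2 / 2), by positivity, fun η ξ c hc hξ => ?_⟩
  have h1 : ∑ j, ∑ i, w i * ((c i j + ξ i j ^ 2 / 2) * ξ i j ^ 2) ≤
      (∑ i, w i) * (R + R ^ 2 / 2) * ∑ j, ∑ i, ξ i j ^ 2 := by
    rw [Finset.mul_sum]
    refine Finset.sum_le_sum fun j _ => ?_
    rw [Finset.mul_sum]
    refine Finset.sum_le_sum fun i _ => ?_
    have a1 : w i ≤ ∑ i, w i := Finset.single_le_sum (fun i _ => (hw i).le) (Finset.mem_univ i)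
    have a2 : c i j ≤ R := (le_abs_self _).trans (hc i j)
    have a3 : ξ i j ^ 2 ≤ R ^ 2 := sq_le_sq' (abs_le.1 (hξ i j)).1 (abs_le.1 (hξ i j)).2
    have a4 := hw i
    have a5 : (c i j + ξ i j ^ 2 / 2) * ξ i j ^ 2 ≤ (R + R ^ 2 / 2) * ξ i j ^ 2 := by gcongr
    rw [mul_assoc]
    refine (mul_le_mul_of_nonneg_left a5 a4.le).trans ?_
    gcongr
  have n1 : 0 ≤ ∑ j, (η j - y j) ^ 2 := Finset.sum_nonneg fun j _ => sq_nonneg _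
  have n2 : 0 ≤ ∑ j, ∑ i, ξ i j ^ 2 :=
    Finset.sum_nonneg fun j _ => Finset.sum_nonneg fun i _ => sq_nonneg _
  have n3 : 0 ≤ (∑ i, w i) * (R + R ^ 2 / 2) := by positivity
  unfold errorEnergy
  nlinarith [mul_nonneg n3 n1, mul_nonneg hκ.le n2]

/-- The references converge to the equilibrium, the disagreements and the tracking errors vanish,
and the gains converge. Since the gains are monotone and bounded, the error energy converges with
the Lyapunov function; a positive limit would force a definite rate of dissipation. -/
theorem tendsto_of_closedLoop (hf : SmoothLipschitz f) (hmono : StronglyMonotone f)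
    (hG : G.StronglyConnected) (hN : 1 < N) (hy : ∀ i, partialGrad f i y = 0)
    {η : ℝ → EuclideanSpace ℝ (Fin N)} {z : ℝ → Fin N → EuclideanSpace ℝ (Fin N)}
    {c : ℝ → Fin N → Fin N → ℝ}
    (hη : ∀ j t, 0 ≤ t →
      HasDerivWithinAt (fun t => η t j) (-partialGrad f j (z t j)) (Set.Ici 0) t)
    (hz : ∀ i j t, 0 ≤ t → HasDerivWithinAt (fun t => z t i j)
      (-correction (localError G (η t) fun i j => z t i j) (c t) i j) (Set.Ici 0) t)
    (hc : ∀ i j t, 0 ≤ t → HasDerivWithinAt (fun t => c t i j)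
      (localError G (η t) (fun i j => z t i j) i j ^ 2) (Set.Ici 0) t)
    (hc0 : ∀ i j, 0 < c 0 i j) :
    (∀ j, Tendsto (fun t => η t j) atTop (𝓝 (y j))) ∧
    (∀ i j, Tendsto (fun t => z t i j) atTop (𝓝 (y j))) ∧
    (∀ i j, Tendsto (fun t => localError G (η t) (fun i j => z t i j) i j) atTop (𝓝 0)) ∧
    ∀ i j, ∃ L, Tendsto (fun t => c t i j) atTop (𝓝 L) := by
  obtain ⟨w, hw, hnull⟩ := hG.exists_pos_left_null (zero_lt_one.trans hN)
  obtain ⟨μ, hμ, hform⟩ := hG.exists_pinned_form_lower_bound hN hw hnull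
  obtain ⟨κ, α, hκ, hrate⟩ := exists_lyapunovRate_le hf hmono hN hμ hw hform hy
  set ξ : ℝ → Fin N → Fin N → ℝ := fun t => localError G (η t) fun i j => z t i j with hξ
  set Q : ℝ → ℝ := fun t => errorEnergy κ w y (η t) (ξ t) (c t) with hQ
  set V : ℝ → ℝ := fun t => Q t + gainEnergy α w (c t) with hV
  have hVd : ∀ t, 0 ≤ t → HasDerivWithinAt V (lyapunovRate G κ α w y (η t)
      (fun j => partialGrad f j (z t j)) (ξ t) (c t)) (Set.Ici 0) t := fun t ht =>
    hasDerivWithinAt_lyapunov (z := fun t i j => z t i j) (η := fun t => η t) κ α w y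
      (fun j => hη j t ht) (fun i j => hz i j t ht) (fun i j => hc i j t ht)
  have hcmono : ∀ i j, MonotoneOn (fun t => c t i j) (Set.Ici 0) := fun i j =>
    monotoneOn_of_hasDerivWithinAt_nonneg (convex_Ici 0)
      (fun t ht => (hc i j t ht).continuousWithinAt)
      (fun t ht => (hc i j t (interior_subset ht)).mono interior_subset) fun t ht => sq_nonneg _
  have hcnn : ∀ t, 0 ≤ t → ∀ i j, 0 ≤ c t i j := fun t ht i j =>
    (hc0 i j).le.trans (hcmono i j Set.self_mem_Ici ht ht)
  have hVanti : AntitoneOn V (Set.Ici 0) :=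
    antitoneOn_of_hasDerivWithinAt_nonpos (convex_Ici 0)
      (fun t ht => (hVd t ht).continuousWithinAt)
      (fun t ht => (hVd t (interior_subset ht)).mono interior_subset) fun t ht =>
      (hrate _ _ _).trans (neg_nonpos.2 (add_nonneg (Finset.sum_nonneg fun j _ => sq_nonneg _)
        (Finset.sum_nonneg fun j _ => Finset.sum_nonneg fun i _ => sq_nonneg _)))
  obtain ⟨R, hR0, hR⟩ := exists_bound_of_lyapunov_le (y := y) (α := α) hμ hκ hw hform (V 0)
  have hbd := fun t (ht : 0 ≤ t) => hR (η t) (fun i j => z t i j) (c t) (hcnn t ht)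
    (hVanti Set.self_mem_Ici ht ht)
  have hclim : ∀ i j, ∃ L, Tendsto (fun t => c t i j) atTop (𝓝 L) := fun i j =>
    exists_tendsto_of_monotoneOn_Ici (hcmono i j) fun t ht =>
      (le_abs_self _).trans ((hbd t ht).2.2.1 i j)
  have hQ0 : ∀ t, 0 ≤ t → 0 ≤ Q t := fun t ht => errorEnergy_nonneg hκ hw _ (hcnn t ht)
  have hV0 : ∀ t, 0 ≤ t → 0 ≤ V t := fun t ht =>
    add_nonneg (hQ0 t ht) (gainEnergy_nonneg hw _)
  obtain ⟨LV, hLV⟩ : ∃ L, Tendsto V atTop (𝓝 L) := by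
    obtain ⟨L, hL⟩ := exists_tendsto_of_monotoneOn_Ici (M := 0) hVanti.neg fun t ht =>
      neg_nonpos.2 (hV0 t ht)
    exact ⟨-L, by simpa using hL.neg⟩
  choose Lc hLc using hclim
  have hgain : Tendsto (fun t => gainEnergy α w (c t)) atTop (𝓝 (gainEnergy α w Lc)) :=
    (tendsto_finsetSum _ fun j _ => tendsto_finsetSum _ fun i _ =>
      (((hLc i j).sub_const α).pow 2).const_mul (w i)).const_mul (1 / 2)
  obtain ⟨L, hL⟩ : ∃ L, Tendsto Q atTop (𝓝 L) :=
    ⟨_, (hLV.sub hgain).congr fun t => by simp [hV]⟩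
  obtain ⟨K, hK, hKle⟩ := exists_errorEnergy_le (y := y) hκ hw hR0
  have hL0 : L = 0 := by
    have hLnn : 0 ≤ L := ge_of_tendsto hL ((eventually_ge_atTop 0).mono hQ0)
    by_contra hne
    have hLpos : 0 < L := lt_of_le_of_ne hLnn (Ne.symm hne)
    obtain ⟨T, hT⟩ := eventually_atTop.1 ((hL.eventually (lt_mem_nhds (half_lt_self hLpos))).and
      (eventually_ge_atTop 0))
    have hT0 : 0 ≤ T := (hT T le_rfl).2
    have hdiss : ∀ t, T ≤ t → lyapunovRate G κ α w y (η t)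
        (fun j => partialGrad f j (z t j)) (ξ t) (c t) ≤ -(L / 2 / K) := fun t ht => by
      have b := hbd t (hT0.trans ht)
      have h1 := hKle (η t) (ξ t) (c t) b.2.2.1 b.2.2.2
      have h2 := (hT t ht).1
      refine (hrate _ _ _).trans (neg_le_neg ?_)
      rw [div_le_iff₀ hK, mul_comm]
      exact h2.le.trans h1
    obtain ⟨t, ht, htlt⟩ := exists_lt_of_deriv_le_neg (by positivity)
      (fun t ht => (hVd t (hT0.trans ht)).mono (Set.Ici_subset_Ici.2 hT0)) hdiss 0
    exact (hV0 t (hT0.trans ht)).not_gt htlt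
  rw [hL0] at hL
  have hηlim : ∀ j, Tendsto (fun t => η t j - y j) atTop (𝓝 0) := fun j => by
    refine tendsto_zero_of_sq ?_
    have h2 : Tendsto (fun t => 2 / κ * Q t) atTop (𝓝 0) := by simpa using hL.const_mul (2 / κ)
    refine squeeze_zero' (Eventually.of_forall fun t => sq_nonneg _) ?_ h2
    filter_upwards [eventually_ge_atTop 0] with t ht
    have h3 := (le_errorEnergy (y := y) (ξ := ξ t) hκ hw (η t) (hcnn t ht)).1 j
    rw [div_mul_eq_mul_div, le_div_iff₀ hκ]
    simp only [hQ]
    linarith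
  have hξlim : ∀ i j, Tendsto (fun t => ξ t i j) atTop (𝓝 0) := fun i j => by
    refine tendsto_zero_of_sq (tendsto_zero_of_sq ?_)
    have h2 : Tendsto (fun t => 2 / w i * Q t) atTop (𝓝 0) := by
      simpa using hL.const_mul (2 / w i)
    refine squeeze_zero' (Eventually.of_forall fun t => sq_nonneg _) ?_ h2
    filter_upwards [eventually_ge_atTop 0] with t ht
    have h3 := (le_errorEnergy (y := y) (ξ := ξ t) hκ hw (η t) (hcnn t ht)).2 i j
    rw [div_mul_eq_mul_div, le_div_iff₀ (hw i)]
    simp only [hQ]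
    linarith
  have hηlim' : ∀ j, Tendsto (fun t => η t j) atTop (𝓝 (y j)) := fun j => by
    simpa using (hηlim j).add_const (y j)
  refine ⟨hηlim', fun i j => ?_, hξlim, fun i j => ⟨_, hLc i j⟩⟩
  have htrack : Tendsto (fun t => z t i j - η t j) atTop (𝓝 0) := by
    refine tendsto_zero_of_sq ?_
    have h2 : Tendsto (fun t => (∑ i, w i ^ 2) / μ ^ 2 * ∑ j, ∑ i, ξ t i j ^ 2) atTop (𝓝 0) := by
      have : Tendsto (fun t => (∑ i, w i ^ 2) / μ ^ 2 * ∑ j, ∑ i, ξ t i j ^ 2) atTop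
          (𝓝 ((∑ i, w i ^ 2) / μ ^ 2 * ∑ j : Fin N, ∑ i : Fin N, (0 : ℝ) ^ 2)) :=
        (tendsto_finsetSum _ fun j _ => tendsto_finsetSum _ fun i _ =>
          (hξlim i j).pow 2).const_mul _
      simpa using this
    refine squeeze_zero (fun t => sq_nonneg _) (fun t => ?_) h2
    refine le_trans ?_ (sum_sq_tracking_le hμ hform (η t) fun i j => z t i j)
    exact le_sum_sum (F := fun j i => (z t i j - η t j) ^ 2) (fun j i => sq_nonneg _) j i
  simpa using htrack.add (hηlim' j)

end Convergence

/-! ### The saturated tracking loop -/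

section Saturation

theorem sat_eq_clamp {D : ℝ} (hD : 0 < D) (s : ℝ) : sat D s = max (-D) (min s D) := by
  rcases lt_trichotomy s 0 with h | h | h
  · rw [sat, Real.sign_of_neg h, abs_of_neg h, min_eq_left (h.le.trans hD.le)]
    rcases le_total (-s) D with h' | h'
    · rw [min_eq_left h', max_eq_right (by linarith)]; ring
    · rw [min_eq_right h', max_eq_left (by linarith)]; ring
  · subst h
    simp [sat, hD.le]
  · rw [sat, Real.sign_of_pos h, abs_of_pos h, one_mul, max_eq_right]
    exact le_min (by linarith) (by linarith)

theorem continuous_sat {D : ℝ} (hD : 0 < D) : Continuous (sat D) := by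
  rw [show sat D = _ from funext (sat_eq_clamp hD)]
  fun_prop

/-- Tracking a convergent reference through a saturated velocity. Once the reference is within
`ε / 2` of its limit, the squared error decreases at a definite rate while it is at least `ε²`. -/
theorem tendsto_of_saturated_tracking {D y : ℝ} (hD : 0 < D) {x η : ℝ → ℝ}
    (hx : ∀ t, 0 ≤ t → HasDerivWithinAt x (-sat D (x t - η t)) (Set.Ici 0) t)
    (hη : Tendsto η atTop (𝓝 y)) : Tendsto x atTop (𝓝 y) := by
  rw [Metric.tendsto_nhds]
  intro ε' hε'
  set ε := ε' / 2 with hεdef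
  have hε : 0 < ε := half_pos hε'
  obtain ⟨T, hT⟩ := eventually_atTop.1 ((Metric.tendsto_nhds.1 hη (ε / 2) (half_pos hε)).and
    (eventually_ge_atTop 0))
  have hT0 : 0 ≤ T := (hT T le_rfl).2
  have hev := eventually_le_of_deriv_le_neg (g := fun t => (x t - y) ^ 2) (T := T)
    (g' := fun t => 2 * (x t - y) * -sat D (x t - η t))
    (δ := 2 * (ε * min (ε / 2) D)) (B := ε ^ 2) (by positivity)
    (fun t ht => by
      refine ((((hx t (hT0.trans ht)).sub_const y).fun_pow 2).mono
        (Set.Ici_subset_Ici.2 hT0)).congr_deriv ?_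
      push_cast
      ring)
    (fun t ht hB => by
      have h1 : |η t - y| < ε / 2 := by
        rw [← Real.dist_eq]; exact (hT t ht).1
      rw [abs_lt] at h1
      have hm : 0 < min (ε / 2) D := by positivity
      have hmε := min_le_left (ε / 2) D
      have hmD := min_le_right (ε / 2) D
      have h2 : ε ≤ |x t - y| := by
        rw [← abs_of_pos hε]; exact sq_le_sq.1 hB
      rw [sat_eq_clamp hD]
      rcases le_abs'.1 h2 with h3 | h3
      · have h4 : max (-D) (min (x t - η t) D) ≤ -min (ε / 2) D :=
          max_le (by linarith) ((min_le_left _ _).trans (by linarith))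
        nlinarith
      · have h4 : min (ε / 2) D ≤ max (-D) (min (x t - η t) D) :=
          le_max_of_le_right (le_min (by linarith) hmD)
        nlinarith)
  filter_upwards [hev] with t ht
  rw [Real.dist_eq]
  have := sq_le_sq.1 ht
  rw [abs_of_pos hε] at this
  linarith

end Saturation

/-! ### Convergence of the closed-loop trajectories -/

section Trajectory

variable {N : ℕ} {G : CommGraph N} {f : Fin N → EuclideanSpace ℝ (Fin N) → ℝ}

theorem exists_lipschitzWith_partialGrad (hf : SmoothLipschitz f) (i : Fin N) :
    ∃ K, LipschitzWith K (partialGrad f i) := by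
  obtain ⟨-, l, -, hlip⟩ := hf
  refine ⟨Real.toNNReal (l i), LipschitzWith.of_dist_le_mul fun y z => ?_⟩
  rw [Real.dist_eq, dist_eq_norm]
  refine (hlip i y z).trans ?_
  gcongr
  exact Real.le_coe_toNNReal _

theorem continuous_partialGrad (hf : SmoothLipschitz f) (i : Fin N) :
    Continuous (partialGrad f i) :=
  (exists_lipschitzWith_partialGrad hf i).choose_spec.continuous

theorem disagreement_eq_localError (z : ℝ → Fin N → EuclideanSpace ℝ (Fin N)) (i j : Fin N)
    (t : ℝ) : disagreement f G z i j t =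
      localError G (fun j => -gradIntegral f z j t) (fun i j => z t i j) i j := by
  simp [disagreement, localError]

theorem IsTrajectory.tendsto_and_boundedConvergent (hN : 1 < N) (hf : SmoothLipschitz f)
    (hmono : StronglyMonotone f) (hG : G.StronglyConnected) {Δ : Fin N → ℝ} (hΔ : ∀ i, 0 < Δ i)
    {y : EuclideanSpace ℝ (Fin N)} (hy : ∀ i, partialGrad f i y = 0)
    {x : ℝ → Fin N → ℝ} {z : ℝ → Fin N → EuclideanSpace ℝ (Fin N)} {c : ℝ → Fin N → Fin N → ℝ}
    (h : IsTrajectory f G Δ x z c) (hc0 : ∀ i j, 0 < c 0 i j) :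
    Tendsto (fun t => ‖output x t - y‖) atTop (𝓝 0) ∧
      (∀ i, BoundedConvergent (fun t => x t i)) ∧
      (∀ i j, BoundedConvergent (fun t => z t i j)) ∧
      (∀ i j, BoundedConvergent (fun t => c t i j)) ∧
      (∀ i j, BoundedConvergent (rho f G z i j)) ∧
      (∀ i, BoundedConvergent (gradIntegral f z i)) ∧
      (∀ i, BoundedConvergent (controlInput f Δ x z i)) := by
  set η : ℝ → EuclideanSpace ℝ (Fin N) :=
    fun t => WithLp.toLp 2 fun j => -gradIntegral f z j t with hη
  have hxi : ∀ i j t, disagreement f G z i j t = localError G (η t) (fun i j => z t i j) i j :=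
    fun i j t => disagreement_eq_localError z i j t
  have hxc : ∀ i, ContinuousOn (fun t => x t i) (Set.Ici 0) := fun i t ht =>
    (h.state_eq i t ht).continuousWithinAt
  have hzc : ∀ i j, ContinuousOn (fun t => z t i j) (Set.Ici 0) := fun i j t ht =>
    (h.estimate_eq i j t ht).continuousWithinAt
  have hcc : ∀ i j, ContinuousOn (fun t => c t i j) (Set.Ici 0) := fun i j t ht =>
    (h.gain_eq i j t ht).continuousWithinAt
  have hzc' : ∀ i, ContinuousOn (fun t => z t i) (Set.Ici 0) := fun i =>
    (PiLp.continuous_toLp 2 _).comp_continuousOn (continuousOn_pi.2 fun j => hzc i j)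
  have hId : ∀ i t, 0 ≤ t →
      HasDerivWithinAt (gradIntegral f z i) (partialGrad f i (z t i)) (Set.Ici 0) t :=
    fun i t ht => hasDerivWithinAt_integral_Ici
      ((continuous_partialGrad hf i).comp_continuousOn (hzc' i)) ht
  have hIc : ∀ i, ContinuousOn (gradIntegral f z i) (Set.Ici 0) := fun i t ht =>
    (hId i t ht).continuousWithinAt
  obtain ⟨lη, lz, lξ, lc⟩ := tendsto_of_closedLoop (η := η) (z := z) (c := c) hf hmono hG hN hy
    (fun j t ht => (hId j t ht).fun_neg)
    (fun i j t ht => by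
      refine (h.estimate_eq i j t ht).congr_deriv ?_
      rw [rho, hxi, correction]
      ring)
    (fun i j t ht => by
      refine (h.gain_eq i j t ht).congr_deriv ?_
      rw [rho, hxi])
    hc0
  have lI : ∀ i, Tendsto (gradIntegral f z i) atTop (𝓝 (-y i)) := fun i => by
    simpa [hη] using (lη i).neg
  have lx : ∀ i, Tendsto (fun t => x t i) atTop (𝓝 (y i)) := fun i =>
    tendsto_of_saturated_tracking (hΔ i) (η := fun t => η t i)
      (fun t ht => by
        refine (h.state_eq i t ht).congr_deriv ?_
        simp [controlInput, hη])
      (lη i)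
  have hξc : ∀ i j, ContinuousOn (disagreement f G z i j) (Set.Ici 0) := fun i j =>
    (continuousOn_finsetSum _ fun k _ =>
      ((hzc i j).sub (hzc k j)).const_mul (G.weight i k)).add
      (((hzc i j).add (hIc j)).const_mul (G.weight i j))
  refine ⟨?_, fun i => boundedConvergent_of_continuousOn (hxc i) (lx i),
    fun i j => boundedConvergent_of_continuousOn (hzc i j) (lz i j),
    fun i j => ?_, fun i j => ?_, fun i => boundedConvergent_of_continuousOn (hIc i) (lI i),
    fun i => ?_⟩
  · have h1 : Tendsto (fun t => output x t) atTop (𝓝 y) := by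
      have := ((PiLp.continuous_toLp 2 (fun _ : Fin N => ℝ)).tendsto y.ofLp).comp
        (tendsto_pi_nhds.2 fun i => lx i)
      exact this
    exact tendsto_iff_norm_sub_tendsto_zero.1 h1
  · obtain ⟨L, hL⟩ := lc i j
    exact boundedConvergent_of_continuousOn (hcc i j) hL
  · refine boundedConvergent_of_continuousOn ((hξc i j).pow 2) (L := 0 ^ 2) ?_
    have := (lξ i j).pow 2
    refine this.congr fun t => ?_
    rw [rho, hxi]
  · have h1 : Tendsto (fun t => -sat (Δ i) (x t i + gradIntegral f z i t)) atTop
        (𝓝 (-sat (Δ i) (y i + -y i))) :=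
      (((continuous_sat (hΔ i)).tendsto _).comp ((lx i).add (lI i))).neg
    exact boundedConvergent_of_continuousOn
      (((continuous_sat (hΔ i)).comp_continuousOn ((hxc i).add (hIc i))).neg) h1

end Trajectory

/-! ### Bounded Lipschitz vector fields -/

section BoundedLipschitz

/-- `h` is bounded and Lipschitz, with a common constant for the two properties. -/
def IsBoundedLipschitz {E F : Type*} [PseudoMetricSpace E] [NormedAddCommGroup F] (h : E → F) :
    Prop :=
  ∃ C : ℝ, 0 ≤ C ∧ (∀ x, ‖h x‖ ≤ C) ∧ ∀ x y, ‖h x - h y‖ ≤ C * dist x y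

namespace IsBoundedLipschitz

variable {E F F' : Type*} [PseudoMetricSpace E] [NormedAddCommGroup F] [NormedAddCommGroup F']

theorem add {h k : E → F} (hh : IsBoundedLipschitz h) (hk : IsBoundedLipschitz k) :
    IsBoundedLipschitz fun x => h x + k x := by
  obtain ⟨C, hC, h1, h2⟩ := hh
  obtain ⟨D, hD, k1, k2⟩ := hk
  refine ⟨C + D, add_nonneg hC hD, fun x => (norm_add_le _ _).trans (add_le_add (h1 x) (k1 x)),
    fun x y => ?_⟩
  rw [add_sub_add_comm, add_mul]
  exact (norm_add_le _ _).trans (add_le_add (h2 x y) (k2 x y))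

theorem neg {h : E → F} (hh : IsBoundedLipschitz h) : IsBoundedLipschitz fun x => -h x := by
  obtain ⟨C, hC, h1, h2⟩ := hh
  refine ⟨C, hC, fun x => by rw [norm_neg]; exact h1 x, fun x y => ?_⟩
  rw [← neg_sub', norm_neg]
  exact h2 x y

theorem sub {h k : E → F} (hh : IsBoundedLipschitz h) (hk : IsBoundedLipschitz k) :
    IsBoundedLipschitz fun x => h x - k x := by
  simpa only [sub_eq_add_neg] using hh.add hk.neg

theorem const (a : F) : IsBoundedLipschitz fun _ : E => a :=
  ⟨‖a‖, norm_nonneg a, fun _ => le_rfl, fun x y => by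
    rw [sub_self, norm_zero]
    positivity⟩

theorem mul {h k : E → ℝ} (hh : IsBoundedLipschitz h) (hk : IsBoundedLipschitz k) :
    IsBoundedLipschitz fun x => h x * k x := by
  obtain ⟨C, hC, h1, h2⟩ := hh
  obtain ⟨D, hD, k1, k2⟩ := hk
  have hCD : 0 ≤ C * D := mul_nonneg hC hD
  refine ⟨2 * (C * D), by positivity, fun x => ?_, fun x y => ?_⟩
  · rw [norm_mul]
    have := mul_le_mul (h1 x) (k1 x) (norm_nonneg _) hC
    linarith
  · have e : h x * k x - h y * k y = h x * (k x - k y) + (h x - h y) * k y := by ring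
    rw [e]
    refine (norm_add_le _ _).trans ?_
    rw [norm_mul, norm_mul]
    have a1 := mul_le_mul (h1 x) (k2 x y) (norm_nonneg _) hC
    have a2 := mul_le_mul (h2 x y) (k1 y) (norm_nonneg _) (by positivity)
    linarith

theorem sum {ι : Type*} (s : Finset ι) {h : ι → E → F} (hh : ∀ i, IsBoundedLipschitz (h i)) :
    IsBoundedLipschitz fun x => ∑ i ∈ s, h i x := by
  classical
  induction s using Finset.induction_on with
  | empty => simpa using const (E := E) (0 : F)
  | insert i s hi ih =>
    simp_rw [Finset.sum_insert hi]
    exact (hh i).add ih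

theorem comp {g : F → F'} {K : NNReal} (hg : LipschitzWith K g) {h : E → F}
    (hh : IsBoundedLipschitz h) : IsBoundedLipschitz fun x => g (h x) := by
  obtain ⟨C, hC, h1, h2⟩ := hh
  have hK : ∀ a b, ‖g a - g b‖ ≤ K * ‖a - b‖ := fun a b => by
    simpa only [dist_eq_norm] using hg.dist_le_mul a b
  refine ⟨‖g 0‖ + K * C, by positivity, fun x => ?_, fun x y => ?_⟩
  · have a1 := hK (h x) 0
    rw [sub_zero] at a1
    have a2 : K * ‖h x‖ ≤ K * C := by
      have := h1 x
      gcongr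
    have a3 := norm_sub_norm_le (g (h x)) (g 0)
    linarith
  · have a1 := hK (h x) (h y)
    have a2 : K * ‖h x - h y‖ ≤ K * (C * dist x y) := by
      have := h2 x y
      gcongr
    have a3 : 0 ≤ ‖g 0‖ * dist x y := by positivity
    linarith

theorem pi {ι : Type*} [Fintype ι] {h : E → ι → F} (hh : ∀ i, IsBoundedLipschitz fun x => h x i) :
    IsBoundedLipschitz h := by
  choose C hC h1 h2 using hh
  have hle : ∀ i, C i ≤ ∑ i, C i := fun i =>
    Finset.single_le_sum (fun i _ => hC i) (Finset.mem_univ i)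
  have h0 : 0 ≤ ∑ i, C i := Finset.sum_nonneg fun i _ => hC i
  refine ⟨∑ i, C i, h0, fun x => (pi_norm_le_iff_of_nonneg h0).2 fun i => (h1 i x).trans (hle i),
    fun x y => (pi_norm_le_iff_of_nonneg (by positivity)).2 fun i => (h2 i x y).trans ?_⟩
  have := hle i
  gcongr

theorem prodMk {h : E → F} {k : E → F'} (hh : IsBoundedLipschitz h) (hk : IsBoundedLipschitz k) :
    IsBoundedLipschitz fun x => (h x, k x) := by
  obtain ⟨C, hC, h1, h2⟩ := hh
  obtain ⟨D, hD, k1, k2⟩ := hk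
  refine ⟨C + D, add_nonneg hC hD, fun x => ?_, fun x y => ?_⟩
  · exact max_le ((h1 x).trans (by linarith)) ((k1 x).trans (by linarith))
  · refine max_le ((h2 x y).trans ?_) ((k2 x y).trans ?_) <;> gcongr <;> linarith

end IsBoundedLipschitz

/-- A bounded Lipschitz vector field has solutions on the whole half-line: boundedness makes the
Picard-Lindelöf theorem apply on time intervals of any length, and uniqueness glues the
solutions. -/
theorem IsBoundedLipschitz.exists_solution {E : Type*} [NormedAddCommGroup E] [NormedSpace ℝ E]
    [CompleteSpace E] {v : E → E} (hv : IsBoundedLipschitz v) (x₀ : E) :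
    ∃ X : ℝ → E, X 0 = x₀ ∧ ∀ t, 0 ≤ t → HasDerivWithinAt X (v (X t)) (Set.Ici 0) t := by
  obtain ⟨C, hC, hbd, hlip⟩ := hv
  lift C to NNReal using hC
  have hL : LipschitzWith C v := LipschitzWith.of_dist_le_mul fun x y => by
    rw [dist_eq_norm]; exact hlip x y
  have hn : ∀ n : ℕ, ∃ α : ℝ → E, α 0 = x₀ ∧
      ∀ t ∈ Set.Icc (0 : ℝ) n, HasDerivWithinAt α (v (α t)) (Set.Icc 0 n) t := by
    intro n
    have hP : IsPicardLindelof (fun _ => v) (⟨0, le_rfl, n.cast_nonneg⟩ : Set.Icc (0 : ℝ) n) x₀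
        (C * n) 0 C C :=
      { lipschitzOnWith := fun t _ => hL.lipschitzOnWith
        continuousOn := fun x _ => continuousOn_const
        norm_le := fun t _ x _ => hbd x
        mul_max_le := by simp }
    exact hP.exists_eq_forall_mem_Icc_hasDerivWithinAt₀
  choose α hα0 hα using hn
  have hcont : ∀ n, ContinuousOn (α n) (Set.Icc 0 n) := fun n t ht =>
    (hα n t ht).continuousWithinAt
  have hright : ∀ (n : ℕ) (b : ℝ), b ≤ n → ∀ t ∈ Set.Ico (0 : ℝ) b,
      HasDerivWithinAt (α n) (v (α n t)) (Set.Ici t) t := fun n b hb t ht =>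
    (hα n t ⟨ht.1, ht.2.le.trans hb⟩).mono_of_mem_nhdsWithin
      (mem_of_superset (Icc_mem_nhdsGE (ht.2.trans_le hb)) (Set.Icc_subset_Icc_left ht.1))
  have huniq : ∀ m n : ℕ, ∀ t ∈ Set.Icc (0 : ℝ) (min m n), α m t = α n t := fun m n =>
    ODE_solution_unique (fun _ => hL)
      ((hcont m).mono (Set.Icc_subset_Icc_right (min_le_left _ _)))
      (hright m _ (min_le_left _ _))
      ((hcont n).mono (Set.Icc_subset_Icc_right (min_le_right _ _)))
      (hright n _ (min_le_right _ _)) ((hα0 m).trans (hα0 n).symm)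
  have hX : ∀ n : ℕ, ∀ t ∈ Set.Icc (0 : ℝ) n, α ⌈t⌉₊ t = α n t := fun n t ht =>
    huniq _ _ t ⟨ht.1, le_min (Nat.le_ceil t) ht.2⟩
  refine ⟨fun t => α ⌈t⌉₊ t, hα0 _, fun t ht => ?_⟩
  have htn : t < ((⌈t⌉₊ + 1 : ℕ) : ℝ) := by
    push_cast
    linarith [Nat.le_ceil t]
  have hmem : t ∈ Set.Icc (0 : ℝ) ((⌈t⌉₊ + 1 : ℕ) : ℝ) := ⟨ht, htn.le⟩
  have h1 := (hα (⌈t⌉₊ + 1) t hmem).congr (fun s hs => hX _ s hs) (hX _ t hmem)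
  rw [← hX _ t hmem] at h1
  refine h1.mono_of_mem_nhdsWithin ?_
  rw [mem_nhdsWithin]
  exact ⟨Set.Iio _, isOpen_Iio, htn, fun s hs => ⟨hs.2, hs.1.le⟩⟩

theorem abs_sat_le {D : ℝ} (hD : 0 < D) (s : ℝ) : |sat D s| ≤ D := by
  rw [sat_eq_clamp hD, abs_le]
  exact ⟨le_max_left _ _, max_le (by linarith) (min_le_right _ _)⟩

theorem lipschitzWith_sat {D : ℝ} (hD : 0 < D) : LipschitzWith 1 (sat D) := by
  rw [show sat D = _ from funext (sat_eq_clamp hD)]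
  exact (LipschitzWith.id.min_const D).const_max (-D)

theorem sat_eq_self {D s : ℝ} (hD : 0 < D) (hs : |s| ≤ D) : sat D s = s := by
  rw [abs_le] at hs
  rw [sat_eq_clamp hD, min_eq_left hs.2, max_eq_right hs.1]

theorem isBoundedLipschitz_sat {E : Type*} [PseudoMetricSpace E] {D : ℝ} (hD : 0 < D) {h : E → ℝ}
    {K : NNReal} (hh : LipschitzWith K h) : IsBoundedLipschitz fun x => sat D (h x) := by
  refine ⟨D + K, by positivity, fun x => (abs_sat_le hD _).trans (by simp), fun x y => ?_⟩
  have h1 := ((lipschitzWith_sat hD).comp hh).dist_le_mul x y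
  rw [one_mul, dist_eq_norm] at h1
  refine h1.trans ?_
  gcongr
  linarith

end BoundedLipschitz

/-! ### Existence of closed-loop trajectories -/

section Existence

variable {N : ℕ} {G : CommGraph N} {f : Fin N → EuclideanSpace ℝ (Fin N) → ℝ}

/-- States of the closed loop: the states `x_{i1}`, the references `η_j` that stand for the negated
gradient integrals, the estimates `z_{ij}` and the gains `c_{ij}`. -/
abbrev LoopState (N : ℕ) : Type :=
  (Fin N → ℝ) × (Fin N → ℝ) × (Fin N → Fin N → ℝ) × (Fin N → Fin N → ℝ)

/-- The disagreements at a state whose references and estimates are cut off at `±R`. -/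
noncomputable def cutError (G : CommGraph N) (R : ℝ) (X : LoopState N) : Fin N → Fin N → ℝ :=
  localError G (fun j => sat R (X.2.1 j)) fun i j => sat R (X.2.2.1 i j)

/-- The vector field of the closed loop, evaluated after the references, estimates and gains have
been cut off at `±R`; the cutoff makes it bounded and globally Lipschitz. -/
noncomputable def cutField (f : Fin N → EuclideanSpace ℝ (Fin N) → ℝ) (G : CommGraph N)
    (Δ : Fin N → ℝ) (R : ℝ) (X : LoopState N) : LoopState N :=
  (fun i => -sat (Δ i) (X.1 i - X.2.1 i),
    fun j => -partialGrad f j (WithLp.toLp 2 fun k => sat R (X.2.2.1 j k)),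
    fun i j => -correction (cutError G R X) (fun i j => sat R (X.2.2.2 i j)) i j,
    fun i j => cutError G R X i j ^ 2)

theorem differentiableWithinAt_lyapunov (κ α : ℝ) (w : Fin N → ℝ) (y : EuclideanSpace ℝ (Fin N))
    {η : ℝ → Fin N → ℝ} {ξ c : ℝ → Fin N → Fin N → ℝ} {s : Set ℝ} {t : ℝ}
    (hη : ∀ j, DifferentiableWithinAt ℝ (fun t => η t j) s t)
    (hξ : ∀ i j, DifferentiableWithinAt ℝ (fun t => ξ t i j) s t)
    (hc : ∀ i j, DifferentiableWithinAt ℝ (fun t => c t i j) s t) :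
    DifferentiableWithinAt ℝ
      (fun t => errorEnergy κ w y (η t) (ξ t) (c t) + gainEnergy α w (c t)) s t := by
  refine DifferentiableWithinAt.fun_add (DifferentiableWithinAt.fun_add
    (.const_mul (.fun_sum fun j _ => ((hη j).sub_const _).fun_pow 2) _)
    (.fun_sum fun j _ => .fun_sum fun i _ => ?_))
    (.const_mul (.fun_sum fun j _ => .fun_sum fun i _ => ?_) _)
  · exact .const_mul (((hc i j).fun_add (((hξ i j).fun_pow 2).div_const 2)).fun_mul
      ((hξ i j).fun_pow 2)) _
  · exact .const_mul (((hc i j).sub_const α).fun_pow 2) _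

theorem isBoundedLipschitz_cutField (hf : SmoothLipschitz f) (G : CommGraph N) {Δ : Fin N → ℝ}
    (hΔ : ∀ i, 0 < Δ i) {R : ℝ} (hR : 0 < R) : IsBoundedLipschitz (cutField f G Δ R) := by
  have hx : ∀ i, LipschitzWith 1 fun X : LoopState N => X.1 i := fun i =>
    ((LipschitzWith.eval i).comp LipschitzWith.prod_fst).weaken (by simp)
  have hη : ∀ i, LipschitzWith 1 fun X : LoopState N => X.2.1 i := fun i =>
    ((LipschitzWith.eval i).comp (LipschitzWith.prod_fst.comp LipschitzWith.prod_snd)).weaken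
      (by simp)
  have hz : ∀ i j, LipschitzWith 1 fun X : LoopState N => X.2.2.1 i j := fun i j =>
    ((LipschitzWith.eval j).comp ((LipschitzWith.eval i).comp (LipschitzWith.prod_fst.comp
      (LipschitzWith.prod_snd.comp LipschitzWith.prod_snd)))).weaken (by simp)
  have hc : ∀ i j, LipschitzWith 1 fun X : LoopState N => X.2.2.2 i j := fun i j =>
    ((LipschitzWith.eval j).comp ((LipschitzWith.eval i).comp (LipschitzWith.prod_snd.comp
      (LipschitzWith.prod_snd.comp LipschitzWith.prod_snd)))).weaken (by simp)
  have bη := fun i => isBoundedLipschitz_sat hR (hη i)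
  have bz := fun i j => isBoundedLipschitz_sat hR (hz i j)
  have bc := fun i j => isBoundedLipschitz_sat hR (hc i j)
  have bξ : ∀ i j, IsBoundedLipschitz fun X => cutError G R X i j := fun i j =>
    (IsBoundedLipschitz.sum _ fun k =>
      (IsBoundedLipschitz.const (G.weight i k)).mul ((bz i j).sub (bz k j))).add
      ((IsBoundedLipschitz.const (G.weight i j)).mul ((bz i j).sub (bη j)))
  have bρ : ∀ i j, IsBoundedLipschitz fun X => cutError G R X i j ^ 2 := fun i j => by
    simpa only [pow_two] using (bξ i j).mul (bξ i j)
  refine .prodMk (.pi fun i => ?_) (.prodMk (.pi fun j => ?_) (.prodMk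
    (.pi fun i => .pi fun j => ?_) (.pi fun i => .pi fun j => bρ i j)))
  · exact (isBoundedLipschitz_sat (hΔ i) ((hx i).sub (hη i))).neg
  · obtain ⟨K, hK⟩ := exists_lipschitzWith_partialGrad hf j
    refine (IsBoundedLipschitz.comp hK (IsBoundedLipschitz.comp
      (PiLp.lipschitzWith_toLp 2 fun _ : Fin N => ℝ) (.pi fun k => ?_))).neg
    exact bz j k
  · exact (((bc i j).add (bρ i j)).mul (bξ i j)).neg

/-- The closed loop has global solutions. The cutoff is put beyond the sublevel set of the Lyapunov
function `V` at height `V X₀ + 1`; since `V` does not increase where the cutoff is inactive, a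
solution of the cut-off loop stays in that sublevel set. -/
theorem exists_closedLoop_solution (hf : SmoothLipschitz f) (hmono : StronglyMonotone f)
    (hG : G.StronglyConnected) (hN : 1 < N) {Δ : Fin N → ℝ} (hΔ : ∀ i, 0 < Δ i)
    (X₀ : LoopState N) (hc₀ : ∀ i j, 0 < X₀.2.2.2 i j) :
    ∃ X : ℝ → LoopState N, X 0 = X₀ ∧ ∀ t, 0 ≤ t →
      (∀ i, HasDerivWithinAt (fun t => (X t).1 i) (-sat (Δ i) ((X t).1 i - (X t).2.1 i))
        (Set.Ici 0) t) ∧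
      (∀ j, HasDerivWithinAt (fun t => (X t).2.1 j)
        (-partialGrad f j (WithLp.toLp 2 ((X t).2.2.1 j))) (Set.Ici 0) t) ∧
      (∀ i j, HasDerivWithinAt (fun t => (X t).2.2.1 i j)
        (-correction (localError G (X t).2.1 (X t).2.2.1) (X t).2.2.2 i j) (Set.Ici 0) t) ∧
      ∀ i j, HasDerivWithinAt (fun t => (X t).2.2.2 i j)
        (localError G (X t).2.1 (X t).2.2.1 i j ^ 2) (Set.Ici 0) t := by
  obtain ⟨y, hy⟩ := exists_stationary hf hmono
  obtain ⟨w, hw, hnull⟩ := hG.exists_pos_left_null (zero_lt_one.trans hN)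
  obtain ⟨μ, hμ, hform⟩ := hG.exists_pinned_form_lower_bound hN hw hnull
  obtain ⟨κ, α, hκ, hrate⟩ := exists_lyapunovRate_le hf hmono hN hμ hw hform hy
  set V : LoopState N → ℝ := fun X =>
    errorEnergy κ w y X.2.1 (localError G X.2.1 X.2.2.1) X.2.2.2 + gainEnergy α w X.2.2.2 with hV
  obtain ⟨R, hR0, hR⟩ :=
    exists_bound_of_lyapunov_le (y := y) (α := α) hμ hκ hw hform (V X₀ + 1)
  have hR1 : 0 < R + 1 := by linarith
  obtain ⟨X, hX0, hX⟩ :=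
    (isBoundedLipschitz_cutField hf G hΔ hR1).exists_solution X₀
  have dx : ∀ t, 0 ≤ t → ∀ i, HasDerivWithinAt (fun t => (X t).1 i)
      ((cutField f G Δ (R + 1) (X t)).1 i) (Set.Ici 0) t := fun t ht i =>
    hasDerivWithinAt_pi.1 (hX t ht).fst i
  have dη : ∀ t, 0 ≤ t → ∀ i, HasDerivWithinAt (fun t => (X t).2.1 i)
      ((cutField f G Δ (R + 1) (X t)).2.1 i) (Set.Ici 0) t := fun t ht i =>
    hasDerivWithinAt_pi.1 (hX t ht).snd.fst i
  have dz : ∀ t, 0 ≤ t → ∀ i j, HasDerivWithinAt (fun t => (X t).2.2.1 i j)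
      ((cutField f G Δ (R + 1) (X t)).2.2.1 i j) (Set.Ici 0) t := fun t ht i j =>
    hasDerivWithinAt_pi.1 (hasDerivWithinAt_pi.1 (hX t ht).snd.snd.fst i) j
  have dc : ∀ t, 0 ≤ t → ∀ i j, HasDerivWithinAt (fun t => (X t).2.2.2 i j)
      ((cutField f G Δ (R + 1) (X t)).2.2.2 i j) (Set.Ici 0) t := fun t ht i j =>
    hasDerivWithinAt_pi.1 (hasDerivWithinAt_pi.1 (hX t ht).snd.snd.snd i) j
  have hcnn : ∀ t, 0 ≤ t → ∀ i j, 0 ≤ (X t).2.2.2 i j := fun t ht i j => by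
    have hmon : MonotoneOn (fun t => (X t).2.2.2 i j) (Set.Ici 0) :=
      monotoneOn_of_hasDerivWithinAt_nonneg (convex_Ici 0)
        (fun t ht => (dc t ht i j).continuousWithinAt)
        (fun t ht => (dc t (interior_subset ht) i j).mono interior_subset) fun t ht => sq_nonneg _
    have h0 := hc₀ i j
    rw [← hX0] at h0
    exact h0.le.trans (hmon Set.self_mem_Ici ht ht)
  have hloop : ∀ t, 0 ≤ t → V (X t) ≤ V X₀ + 1 →
      (∀ j, (cutField f G Δ (R + 1) (X t)).2.1 j =
        -partialGrad f j (WithLp.toLp 2 ((X t).2.2.1 j))) ∧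
      (∀ i j, (cutField f G Δ (R + 1) (X t)).2.2.1 i j =
        -correction (localError G (X t).2.1 (X t).2.2.1) (X t).2.2.2 i j) ∧
      ∀ i j, (cutField f G Δ (R + 1) (X t)).2.2.2 i j =
        localError G (X t).2.1 (X t).2.2.1 i j ^ 2 := by
    intro t ht hVt
    obtain ⟨b1, b2, b3, -⟩ := hR _ _ _ (hcnn t ht) hVt
    have e1 : (fun j => sat (R + 1) ((X t).2.1 j)) = (X t).2.1 := funext fun j =>
      sat_eq_self hR1 ((b1 j).trans (by linarith))
    have e2 : (fun i j => sat (R + 1) ((X t).2.2.1 i j)) = (X t).2.2.1 := funext fun i =>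
      funext fun j => sat_eq_self hR1 ((b2 i j).trans (by linarith))
    have e3 : (fun i j => sat (R + 1) ((X t).2.2.2 i j)) = (X t).2.2.2 := funext fun i =>
      funext fun j => sat_eq_self hR1 ((b3 i j).trans (by linarith))
    have e4 : cutError G (R + 1) (X t) = localError G (X t).2.1 (X t).2.2.1 := by
      rw [cutError, e1, e2]
    refine ⟨fun j => ?_, fun i j => ?_, fun i j => ?_⟩
    · have := congrFun e2 j
      simp only [cutField, this]
    · simp only [cutField, e4, e3]
    · simp only [cutField, e4]
  have hVle : ∀ T, 0 ≤ T → V (X T) ≤ V X₀ + 1 := by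
    intro T hT
    -- the fence `V X₀ + ε t`, of positive slope, stays below the height `V X₀ + 1` up to time `T`
    set ε : ℝ := 1 / (T + 1) with hε
    have hε0 : 0 < ε := by positivity
    have hεT : ∀ t, t ≤ T → ε * t ≤ 1 := fun t ht => by
      rw [hε, div_mul_eq_mul_div, one_mul, div_le_one (by linarith)]
      linarith
    have hdiff : ∀ t, 0 ≤ t → DifferentiableWithinAt ℝ (fun t => V (X t)) (Set.Ici 0) t := by
      intro t ht
      have d1 := fun j => (dη t ht j).differentiableWithinAt
      have d3 := fun i j => (dc t ht i j).differentiableWithinAt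
      have d4 : ∀ i j, DifferentiableWithinAt ℝ
          (fun t => localError G (X t).2.1 (X t).2.2.1 i j) (Set.Ici 0) t := fun i j =>
        (hasDerivWithinAt_localError (η := fun t => (X t).2.1) (z := fun t => (X t).2.2.1)
          (dη t ht) (dz t ht) i j).differentiableWithinAt
      exact differentiableWithinAt_lyapunov κ α w y d1 d4 d3
    have hfence := image_le_of_deriv_right_lt_deriv_boundary (a := 0) (b := T)
      (f := fun t => V (X t)) (f' := fun s => derivWithin (fun t => V (X t)) (Set.Ici s) s)
      (B := fun t => V X₀ + ε * t) (B' := fun _ => ε)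
      (fun t ht => (hdiff t ht.1).continuousWithinAt.mono Set.Icc_subset_Ici_self)
      (fun t ht => ((hdiff t ht.1).mono (Set.Ici_subset_Ici.2 ht.1)).hasDerivWithinAt)
      (by simp [hX0])
      (fun t => by simpa using ((hasDerivAt_id t).const_mul ε).const_add (V X₀))
      (fun t ht hVt => by
        have hle : V (X t) ≤ V X₀ + 1 := by
          rw [hVt]
          linarith [hεT t ht.2.le]
        obtain ⟨l1, l2, l3⟩ := hloop t ht.1 hle
        have hd := (hasDerivWithinAt_lyapunov (G := G) (η := fun t => (X t).2.1)
          (z := fun t => (X t).2.2.1) (c := fun t => (X t).2.2.2) κ α w y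
          (fun j => (dη t ht.1 j).congr_deriv (l1 j))
          (fun i j => (dz t ht.1 i j).congr_deriv (l2 i j))
          (fun i j => (dc t ht.1 i j).congr_deriv (l3 i j))).mono (Set.Ici_subset_Ici.2 ht.1)
        have hr := hrate (WithLp.toLp 2 (X t).2.1) (fun i => WithLp.toLp 2 ((X t).2.2.1 i))
          (X t).2.2.2
        have hneg := hr.trans (neg_nonpos.2 (add_nonneg (Finset.sum_nonneg fun j _ => sq_nonneg _)
          (Finset.sum_nonneg fun j _ => Finset.sum_nonneg fun i _ => sq_nonneg _)))
        have he := hd.derivWithin (uniqueDiffWithinAt_Ici t)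
        exact (he.trans_le hneg).trans_lt hε0)
    have h1 := hfence ⟨hT, le_rfl⟩
    have h2 := hεT T le_rfl
    linarith
  refine ⟨X, hX0, fun t ht => ?_⟩
  obtain ⟨l1, l2, l3⟩ := hloop t ht (hVle t ht)
  exact ⟨dx t ht, fun j => (dη t ht j).congr_deriv (l1 j),
    fun i j => (dz t ht i j).congr_deriv (l2 i j), fun i j => (dc t ht i j).congr_deriv (l3 i j)⟩

theorem exists_isTrajectory (hf : SmoothLipschitz f) (hmono : StronglyMonotone f)
    (hG : G.StronglyConnected) (hN : 1 < N) {Δ : Fin N → ℝ} (hΔ : ∀ i, 0 < Δ i)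
    (x₀ : Fin N → ℝ) (z₀ : Fin N → EuclideanSpace ℝ (Fin N)) (c₀ : Fin N → Fin N → ℝ)
    (hc₀ : ∀ i j, 0 < c₀ i j) :
    ∃ (x : ℝ → Fin N → ℝ) (z : ℝ → Fin N → EuclideanSpace ℝ (Fin N)) (c : ℝ → Fin N → Fin N → ℝ),
      IsTrajectory f G Δ x z c ∧ x 0 = x₀ ∧ z 0 = z₀ ∧ c 0 = c₀ := by
  obtain ⟨X, hX0, hX⟩ := exists_closedLoop_solution hf hmono hG hN hΔ
    (x₀, 0, fun i j => z₀ i j, c₀) hc₀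
  set z : ℝ → Fin N → EuclideanSpace ℝ (Fin N) := fun t i => WithLp.toLp 2 ((X t).2.2.1 i) with hz
  have hzc : ∀ i, ContinuousOn (fun t => z t i) (Set.Ici 0) := fun i =>
    (PiLp.continuous_toLp 2 _).comp_continuousOn
      (continuousOn_pi.2 fun j t ht => ((hX t ht).2.2.1 i j).continuousWithinAt)
  have hint : ∀ t, 0 ≤ t → ∀ j, gradIntegral f z j t = -(X t).2.1 j := by
    intro t ht j
    have hcont : ContinuousOn (fun τ => partialGrad f j (z τ j)) (Set.Ici 0) :=
      (continuous_partialGrad hf j).comp_continuousOn (hzc j)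
    have h1 := intervalIntegral.integral_eq_sub_of_hasDerivAt_of_le (a := 0) (b := t)
      (f := fun t => -(X t).2.1 j) (f' := fun τ => partialGrad f j (z τ j)) ht
      (fun s hs => ((hX s hs.1).2.1 j).continuousWithinAt.neg.mono Set.Icc_subset_Ici_self)
      (fun s hs => by
        simpa using (((hX s hs.1.le).2.1 j).hasDerivAt (Ici_mem_nhds hs.1)).fun_neg)
      (hcont.mono (by rw [Set.uIcc_of_le ht]; exact Set.Icc_subset_Ici_self)).intervalIntegrable
    rw [gradIntegral, h1, hX0]
    simp
  have hξ : ∀ t, 0 ≤ t → ∀ i j,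
      disagreement f G z i j t = localError G (X t).2.1 (X t).2.2.1 i j := by
    intro t ht i j
    rw [disagreement_eq_localError]
    have : (fun j => -gradIntegral f z j t) = (X t).2.1 := funext fun j => by
      rw [hint t ht j, neg_neg]
    rw [this]
  refine ⟨fun t => (X t).1, z, fun t => (X t).2.2.2, ⟨fun i t ht => ?_, fun i j t ht => ?_,
    fun i j t ht => ?_⟩, by simp [hX0], ?_, by simp [hX0]⟩
  · refine ((hX t ht).1 i).congr_deriv ?_
    rw [controlInput, hint t ht i, sub_eq_add_neg]
  · refine ((hX t ht).2.2.1 i j).congr_deriv ?_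
    rw [rho, hξ t ht, correction]
    ring
  · refine ((hX t ht).2.2.2 i j).congr_deriv ?_
    rw [rho, hξ t ht]
  · simp [hz, hX0]

end Existence

end NashSeeking

theorem corollary1 {N : ℕ} (hN : 1 < N)
    (f : Fin N → EuclideanSpace ℝ (Fin N) → ℝ)
    (hf : SmoothLipschitz f) (hmono : StronglyMonotone f)
    (G : CommGraph N) (hG : G.StronglyConnected)
    (Δ : Fin N → ℝ) (hΔ : ∀ i, 0 < Δ i) :
    (∃! yStar : EuclideanSpace ℝ (Fin N), IsNashEquilibrium f yStar) ∧
    (∀ (x₀ : Fin N → ℝ) (z₀ : Fin N → EuclideanSpace ℝ (Fin N)) (c₀ : Fin N → Fin N → ℝ),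
      (∀ i j, 0 < c₀ i j) →
      ∃ (x : ℝ → Fin N → ℝ) (z : ℝ → Fin N → EuclideanSpace ℝ (Fin N))
        (c : ℝ → Fin N → Fin N → ℝ),
        IsTrajectory f G Δ x z c ∧ x 0 = x₀ ∧ z 0 = z₀ ∧ c 0 = c₀) ∧
    (∀ (yStar : EuclideanSpace ℝ (Fin N)), IsNashEquilibrium f yStar →
      ∀ (x : ℝ → Fin N → ℝ) (z : ℝ → Fin N → EuclideanSpace ℝ (Fin N))
        (c : ℝ → Fin N → Fin N → ℝ),
        IsTrajectory f G Δ x z c → (∀ i j, 0 < c 0 i j) →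
        Tendsto (fun t => ‖output x t - yStar‖) atTop (𝓝 0) ∧
        (∀ i, BoundedConvergent (fun t => x t i)) ∧
        (∀ i j, BoundedConvergent (fun t => z t i j)) ∧
        (∀ i j, BoundedConvergent (fun t => c t i j)) ∧
        (∀ i j, BoundedConvergent (rho f G z i j)) ∧
        (∀ i, BoundedConvergent (gradIntegral f z i)) ∧
        (∀ i, BoundedConvergent (controlInput f Δ x z i))) := by
  have hstat := fun y => isNashEquilibrium_iff hf hmono y
  exact ⟨existsUnique_isNashEquilibrium hf hmono,
    fun x₀ z₀ c₀ hc₀ => exists_isTrajectory hf hmono hG hN hΔ x₀ z₀ c₀ hc₀,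
    fun yStar hy x z c htraj hc₀ =>
      htraj.tendsto_and_boundedConvergent hN hf hmono hG hΔ ((hstat yStar).1 hy) hc₀⟩
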